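/- **Setting.** Let $\mathbb T^2=\mathbb R^2/(\lambda_1\mathbb Z\times\lambda_2\mathbb Z)$ with $\lambda_1,\lambda_2>0$ (rational or irrational), with frequencies $\xi=(2\pi n_1/\lambda_1,2\pi n_2/\lambda_2)$, $n\in\mathbb Z^2$, let $|x|$ denote the distance of $x\in\mathbb T^2$ to $0$, and put $\langle\xi\rangle=(1+|\xi|^2)^{1/2}$, $\|f\|_{H^s}=(\sum_\xi\langle\xi\rangle^{2s}|\widehat f(\xi)|^2)^{1/2}$. Fix a spherically symmetric $\eta\in C_0^\infty(\mathbb R^2)$ supported in the ball of radius $2$ and equal to $1$ on the ball of radius $1$; $P_{>M}$ is the Fourier multiplier with symbol $1-\eta(\xi/M)$, and $e^{it\Delta}$ the one with symbol $e^{-it|\xi|^2}$. A $U^2$-atom is a function $\sum_k\mathbf 1_{[t_k,t_{k+1})}\phi_k$ on $\mathbb R$ with $-\infty=t_0<t_1<\cdots$ a finite sequence (whose last interval extends to $+\infty$) or an infinite one, $\phi_k\in\mathbb C$ and $\sum_k|\phi_k|^2=1$; $\|g\|_{U^2}$ is the infimum of $\sum_j|c_j|$ over representations $g=\sum_j c_ja_j$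 with $U^2$-atoms $a_j$. Let $$\|v\|_{\widetilde X^{s}}=\Big(\sum_\xi\langle\xi\rangle^{2s}\big\|t\mapsto\widehat{e^{-it\Delta}v(t)}(\xi)\big\|_{U^2}^2\Big)^{1/2},\qquad \|u\|_{X^s(I)}=\sup_{J\subset I,\,|J|\le1}\ \inf_{v|_J=u|_J}\|v\|_{\widetilde X^s},$$ where $J$ runs over intervals, $v$ over functions on $\mathbb R$, and $\|u\|_{X^s(I)}=\infty$ unless $u\in C(I:H^s)$. For $I=(a,b)$ let $\|h\|_{N(I)}=\big\|\int_a^te^{i(t-s)\Delta}h(s)\,ds\big\|_{X^{1/2}(I)}$. Finally, $\mathfrak O_{4,1}(a,b)$ denotes a fixed $5$-linear expression (a finite linear combination of products) with four factors, each equal to $a$ or $\overline a$, and one factor equal to $b$ or $\overline b$. **Lemma A.1.** There is a constant $C$, depending only on $\lambda_1,\lambda_2$, $\eta$ and the expression $\mathfrak O_{4,1}$, such that the following holds. Let $B,N\ge2$ be dyadic numbers, and let $\omega:(-1,1)\times\mathbb T^2\to\mathbb C$ be measurable, differentiable in $x$ for every $t$, with $$|\nabla_x^j\omega(t,x)|\le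 N^{j+\frac12}\,\mathbf 1_{\{|t|\le N^{-2},\ |x|\le N^{-1}\}},\qquad j=0,1 .$$ Then for every $f\in H^{1/2}(\mathbb T^2)$ $$\big\|\mathfrak O_{4,1}(\omega,\,e^{it\Delta}P_{>BN}f)\big\|_{N((-1,1))}\le C\,\big(B^{-1/200}+N^{-1/200}\big)\,\|f\|_{H^{1/2}(\mathbb T^2)} ;$$ in particular the left-hand side is finite. -/

import Mathlib

open MeasureTheory Set Filter Topology
open scoped ENNReal ComplexConjugate

noncomputable section

namespace TorusNLS

/-! ### The flat torus and Fourier analysis on it -/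

/-- The torus `ℝ² / (L₀ ℤ × L₁ ℤ)`; the side lengths `L₀, L₁ > 0` are arbitrary, so that rational
and irrational tori are both covered. -/
abbrev Torus (L : Fin 2 → ℝ) : Type := ∀ i : Fin 2, AddCircle (L i)

/-- The length `|x|` of a point of the torus, i.e. its flat distance to the origin. (The norm of
`AddCircle T` is the distance to the nearest multiple of `T`.) -/
def torusAbs {L : Fin 2 → ℝ} (x : Torus L) : ℝ := Real.sqrt (∑ i, ‖x i‖ ^ 2)

/-- The function on `ℝ²`, periodic with respect to `L₀ ℤ × L₁ ℤ`, given by a function on the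
torus. -/
def lift {L : Fin 2 → ℝ} (g : Torus L → ℂ) (x : EuclideanSpace ℝ (Fin 2)) : ℂ :=
  g fun i => (x i : AddCircle (L i))

/-- The length `|∇ g| = (|∂₁ g|² + |∂₂ g|²)^{1/2}` of the gradient at the point of the torus
represented by `x`. -/
def gradAbs {L : Fin 2 → ℝ} (g : Torus L → ℂ) (x : EuclideanSpace ℝ (Fin 2)) : ℝ :=
  Real.sqrt (∑ i, ‖fderiv ℝ (lift g) x (EuclideanSpace.single i 1)‖ ^ 2)

/-- The frequency `ξ = (2π n₀ / L₀, 2π n₁ / L₁)` with index `n ∈ ℤ²`. -/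
def freq (L : Fin 2 → ℝ) (n : Fin 2 → ℤ) : EuclideanSpace ℝ (Fin 2) :=
  WithLp.toLp 2 fun i => 2 * Real.pi * (n i : ℝ) / L i

/-- The character `x ↦ e^{i ξ · x}`, where `ξ = freq L n`. -/
def character (L : Fin 2 → ℝ) (n : Fin 2 → ℤ) : C(Torus L, ℂ) where
  toFun x := ∏ i, fourier (n i) (x i)
  continuous_toFun := by fun_prop

section

variable (L : Fin 2 → ℝ) [∀ i, Fact (0 < L i)]

/-- Lebesgue measure on the torus, normalised to total mass one. -/
def haar : Measure (Torus L) := Measure.pi fun i => (AddCircle.haarAddCircle : Measure (AddCircle (L i)))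

instance : IsProbabilityMeasure (haar L) := by unfold haar; infer_instance

/-- The Hilbert space `L²` of the torus. -/
abbrev L2 : Type := Lp ℂ 2 (haar L)

/-- The class in `L²` of a square integrable function (and `0` for other functions). -/
def toL2 (g : Torus L → ℂ) : L2 L :=
  open Classical in if h : MemLp g 2 (haar L) then h.toLp g else 0

/-- The Fourier coefficient `∫ e^{-i ξ · x} f(x) dx`, `ξ = freq L n`. -/
def coeff (f : L2 L) (n : Fin 2 → ℤ) : ℂ := ∫ x, conj (character L n x) * f x ∂(haar L)

/-- The Fourier multiplier with bounded symbol `m`: the sum in `L²` of the Fourier series with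
coefficients `m n * coeff f n`. -/
def multiplier (m : (Fin 2 → ℤ) → ℂ) (f : L2 L) : L2 L :=
  ∑' n, (m n * coeff L f n) • ContinuousMap.toLp 2 (haar L) ℂ (character L n)

/-- The free Schrödinger propagator `e^{itΔ}`, with symbol `e^{-it|ξ|²}`. -/
def schr (t : ℝ) (f : L2 L) : L2 L :=
  multiplier L (fun n => Complex.exp (-(Complex.I * t * (‖freq L n‖ ^ 2 : ℝ)))) f

/-- The high-frequency projection `P_{>M} = 1 - P_{≤M}`, with symbol `1 - η(ξ / M)`. -/
def highFreq (η : EuclideanSpace ℝ (Fin 2) → ℝ) (M : ℝ) (f : L2 L) : L2 L :=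
  multiplier L (fun n => ((1 - η (M⁻¹ • freq L n) : ℝ) : ℂ)) f

/-- The norm `(∑_ξ ⟨ξ⟩^{2s} |f̂(ξ)|²)^{1/2}` of the Sobolev space `H^s`, `s ≥ 0`, with value `∞`
outside the space; here `⟨ξ⟩ = (1 + |ξ|²)^{1/2}`. -/
def hNorm (s : ℝ) (f : L2 L) : ℝ≥0∞ :=
  (∑' n, ENNReal.ofReal ((1 + ‖freq L n‖ ^ 2) ^ s) * ‖coeff L f n‖ₑ ^ 2) ^ (1 / 2 : ℝ)

/-- `u ∈ C(I : H^s)`. -/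
def ContInH (s : ℝ) (I : Set ℝ) (u : ℝ → L2 L) : Prop :=
  ∀ t ∈ I, hNorm L s (u t) < ∞ ∧ Tendsto (fun r => hNorm L s (u r - u t)) (𝓝[I] t) (𝓝 0)

end

/-! ### Atomic spaces -/

/-- A `U²`-atom: a step function `∑_k 1_{[t_k, t_{k+1})} φ_k` on the line, where
`-∞ = t_0 < t_1 < t_2 < ⋯` is a finite or infinite sequence of times and `∑_k |φ_k|² = 1`. If the
sequence is finite, its last interval ends at `+∞`; this is encoded by letting all later `t_k`
be `+∞` and all later `φ_k` vanish. -/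
def IsU2Atom (a : ℝ → ℂ) : Prop :=
  ∃ (t : ℕ → EReal) (φ : ℕ → ℂ), t 0 = ⊥ ∧
    (∀ k, t k < t (k + 1) ∨ (t k = ⊤ ∧ t (k + 1) = ⊤)) ∧
    (∀ k, t k = ⊤ → φ k = 0) ∧
    HasSum (fun k => ‖φ k‖ ^ 2) 1 ∧
    (∀ k (s : ℝ), t k ≤ (s : EReal) → (s : EReal) < t (k + 1) → a s = φ k) ∧
    (∀ s : ℝ, (∀ k, t k ≤ (s : EReal)) → a s = 0)

/-- The norm of `U²(ℝ; ℂ)`: the infimum of `∑_j |c_j|` over all representations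
`g = ∑_j c_j a_j` with atoms `a_j`; it is `∞` if there is none. -/
def u2Norm (g : ℝ → ℂ) : ℝ≥0∞ :=
  ⨅ (c : ℕ → ℂ) (a : ℕ → ℝ → ℂ) (_ : ∀ j, IsU2Atom (a j)) (_ : Summable fun j => ‖c j‖)
    (_ : ∀ s, HasSum (fun j => c j * a j s) (g s)), ∑' j, ‖c j‖ₑ

section

variable (L : Fin 2 → ℝ) [∀ i, Fact (0 < L i)]

/-- The norm of `X^s` on the whole line,
`(∑_ξ ⟨ξ⟩^{2s} ‖ t ↦ (e^{-itΔ} v(t))^(ξ) ‖_{U²}²)^{1/2}`. -/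
def xNormLine (s : ℝ) (v : ℝ → L2 L) : ℝ≥0∞ :=
  (∑' n, ENNReal.ofReal ((1 + ‖freq L n‖ ^ 2) ^ s) *
    u2Norm (fun t => coeff L (schr L (-t) (v t)) n) ^ 2) ^ (1 / 2 : ℝ)

/-- The norm of `X^s(I)`, `s ≥ 0`: the supremum over the intervals `J ⊆ I` of length at most one
of the restriction norm, with value `∞` outside `C(I : H^s)`. -/
def xNorm (s : ℝ) (I : Set ℝ) (u : ℝ → L2 L) : ℝ≥0∞ :=
  open Classical in
  if ContInH L s I u then
    ⨆ (J : Set ℝ) (_ : J.OrdConnected) (_ : J ⊆ I) (_ : volume J ≤ 1),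
      ⨅ (v : ℝ → L2 L) (_ : EqOn v u J), xNormLine L s v
  else ∞

/-- The Duhamel integral `∫_a^t e^{i(t-s)Δ} h(s) ds`, as an integral in `L²`. -/
def duhamel (a : ℝ) (h : ℝ → L2 L) (t : ℝ) : L2 L := ∫ s in a..t, schr L (t - s) (h s)

/-- The norm `‖h‖_{N(I)} = ‖∫_a^t e^{i(t-s)Δ} h(s) ds‖_{X^{1/2}(I)}`, `I = (a,b)`, of a function
`h` on `I × 𝕋²`. It is `∞` unless `h` belongs to `L¹(I; L²)`, so that a finite value always refers to
a well-defined Duhamel integral. -/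
def nNorm (a b : ℝ) (h : ℝ → Torus L → ℂ) : ℝ≥0∞ :=
  open Classical in
  if (∀ᵐ t ∂(volume.restrict (Ioo a b)), MemLp (h t) 2 (haar L)) ∧
      IntegrableOn (fun t => toL2 L (h t)) (Ioo a b) then
    xNorm L (1 / 2) (Ioo a b) (duhamel L a fun t => toL2 L (h t))
  else ∞

end

/-! ### Cutoffs and quintic expressions -/

/-- A spherically symmetric `η ∈ C_0^∞(ℝ²)`, supported in the ball of radius `2` and equal to `1`
on the ball of radius `1`. -/
structure IsCutoff (η : EuclideanSpace ℝ (Fin 2) → ℝ) : Prop where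
  smooth : ContDiff ℝ ((⊤ : ℕ∞) : WithTop ℕ∞) η
  radial : ∀ x y, ‖x‖ = ‖y‖ → η x = η y
  eq_one : ∀ x, ‖x‖ ≤ 1 → η x = 1
  support : tsupport η ⊆ Metric.closedBall 0 2

/-- `z` or its complex conjugate. -/
def conjIf (σ : Bool) (z : ℂ) : ℂ := if σ then conj z else z

/-- The expression `𝔒_{4,1}(a, b)`, linear in four factors `a` or `ā` and one factor `b` or `b̄`:
the linear combination, with coefficients `κ`, of all such products. -/
def quintic (κ : (Fin 4 → Bool) → Bool → ℂ) (a b : ℂ) : ℂ :=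
  ∑ σ, ∑ τ, κ σ τ * ((∏ i, conjIf (σ i) a) * conjIf τ b)

end TorusNLS

end

namespace TorusNLS

/-! ### Fourier series on the torus -/

section Characters

variable {L : Fin 2 → ℝ}

/-! The expression has the form h = W u + W' ū, where u is the free solution with data g = P_{>BN}
f. The factors W, W' are quartic in ω, hence of size N², Lipschitz with constant of order N³, and
supported in |t| ≤ N⁻², |x| ≤ N⁻¹. Three estimates carry the proof; none of them is multilinear.

Short time. Once the free flow is undone, each Fourier coefficient of the Duhamel integral is a
scalar primitive. A primitive of p supported in [-a, a] has U² norm O(√a ‖p‖_{L²}): sampling on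
dyadic grids writes it as a series of step functions, and Cauchy–Schwarz makes their ℓ² norms decay
like 2^{-k/2} (`u2Norm_primitive_le`). With a = N⁻² this gives ‖h‖_N ≲ N⁻¹ ‖h‖_{L²_t H^{1/2}}
(`xNorm_duhamel_le`).

Local smoothing. A free solution with frequencies beyond BN has space-time mass at most a multiple
of N⁻²(B⁻¹ + N⁻¹)‖g‖² on |t| ≤ N⁻², |x| ≤ N⁻¹ (`lintegral_free_solution_le`). The spatial cutoff is
dominated by the square of a normalised exponential sum over a box of about N² frequencies, so each
output coefficient is an average over a translated box. Integrating in time with a Gaussian weight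
and applying Schur's test leaves a count: how many ξ in a box of side N have |ξ|² within about N² of
|p|², where |p| ≥ BN. One coordinate of p is comparable to |p|, so along each of the O(N) lines in
that direction the values |ξ|² are separated by a multiple of BN and O(1 + N/B) of them qualify
(`sum_box_exp_le`). Dividing by the N² frequencies of the box gives the gain N⁻¹ + B⁻¹.

Half a derivative. The H^{1/2} norm is written through the differences h(x + y) - h(x) in the
coordinate directions, integrated against dy/y². In W(x) (u(x + y) - u(x)) the difference of u is
again a free solution beyond BN, so local smoothing applies. In (W(x + y) - W(x)) u(x + y) only the
mass of u is used: this costs N³‖g‖²_{L²}, which is at most N² B⁻¹ ‖g‖²_{H^{1/2}} as g has no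
frequencies below BN. Both parts are O(N²(B⁻¹ + N⁻¹)‖g‖²_{H^{1/2}})
(`sum_japanese_mul_lintegral_le`). With the factor N⁻² from the short time this yields the lemma
with the better bound (B⁻¹ + N⁻¹)^{1/2}. -/

theorem character_apply (n : Fin 2 → ℤ) (x : Torus L) :
    character L n x = ∏ i, fourier (n i) (x i) := rfl

theorem character_add (m n : Fin 2 → ℤ) (x : Torus L) :
    character L (m + n) x = character L m x * character L n x := by
  simp only [character_apply, Pi.add_apply, fourier_add, Finset.prod_mul_distrib]

theorem character_neg (n : Fin 2 → ℤ) (x : Torus L) :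
    character L (-n) x = conj (character L n x) := by
  simp only [character_apply, Pi.neg_apply, fourier_neg, map_prod]

theorem character_zero (x : Torus L) : character L 0 x = 1 := by
  simp [character_apply]

theorem norm_character (n : Fin 2 → ℤ) (x : Torus L) : ‖character L n x‖ = 1 := by
  have h : ∀ (T : ℝ) (k : ℤ) (z : AddCircle T), ‖fourier k z‖ = 1 := fun T k z => by
    rw [fourier_apply]; exact Circle.norm_coe _
  rw [character_apply, norm_prod]
  exact Finset.prod_eq_one fun i _ => h _ _ _

theorem character_add_arg (n : Fin 2 → ℤ) (x y : Torus L) :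
    character L n (x + y) = character L n x * character L n y := by
  simp only [character_apply, Pi.add_apply, fourier_apply, smul_add, AddCircle.toCircle_add,
    Circle.coe_mul, Finset.prod_mul_distrib]

theorem character_single (z : Torus L) (i : Fin 2) :
    character L (Pi.single i 1) z = fourier 1 (z i) := by
  fin_cases i <;> simp [character_apply, Fin.prod_univ_two]

/-- Stone–Weierstrass: the characters are closed under products and conjugation, so their span is
already a star subalgebra, and the two coordinate characters separate points. -/
theorem span_character_closure_eq_top (hL : ∀ i, L i ≠ 0) [∀ i, Fact (0 < L i)] :
    (Submodule.span ℂ (range (character L))).topologicalClosure = ⊤ := by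
  let A : StarSubalgebra ℂ C(Torus L, ℂ) :=
    { toSubalgebra := Algebra.adjoin ℂ (range (character L))
      star_mem' := by
        change Algebra.adjoin ℂ (range (character L)) ≤
          star (Algebra.adjoin ℂ (range (character L)))
        refine Algebra.adjoin_le ?_
        rintro _ ⟨n, rfl⟩
        refine Algebra.subset_adjoin ⟨-n, ?_⟩
        ext1 x
        simp only [character_neg, starRingEnd_apply, ContinuousMap.star_apply] }
  have hA : A.toSubalgebra.toSubmodule = Submodule.span ℂ (range (character L)) := by
    apply Algebra.adjoin_eq_span_of_subset
    refine .trans (fun x ↦ Submonoid.closure_induction (fun _ ↦ id) ⟨0, ?_⟩ ?_)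
      Submodule.subset_span
    · ext z
      simp [character_zero]
    · rintro _ _ _ _ ⟨m, rfl⟩ ⟨n, rfl⟩
      refine ⟨m + n, ?_⟩
      ext z
      simp [character_add]
  have hsep : A.SeparatesPoints := by
    intro x y hxy
    rw [Ne, funext_iff, not_forall] at hxy
    obtain ⟨i, hi⟩ := hxy
    refine ⟨_, ⟨character L (Pi.single i 1), Algebra.subset_adjoin ⟨Pi.single i 1, rfl⟩, rfl⟩, ?_⟩
    dsimp only
    rw [character_single, character_single, fourier_one, fourier_one]
    exact fun h => hi (AddCircle.injective_toCircle (hL i) (Subtype.ext h))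
  rw [← hA]
  exact congr_arg (Subalgebra.toSubmodule <| StarSubalgebra.toSubalgebra ·)
    (ContinuousMap.starSubalgebra_topologicalClosure_eq_top_of_separatesPoints A hsep)

end Characters

section Phase

variable (L : Fin 2 → ℝ)

/-- The phase `e^{-it|ξ|²}` of the free propagator. -/
noncomputable def phase (t : ℝ) (n : Fin 2 → ℤ) : ℂ :=
  Complex.exp (-(Complex.I * t * (‖freq L n‖ ^ 2 : ℝ)))

theorem phase_eq (t : ℝ) (n : Fin 2 → ℤ) :
    phase L t n = Complex.exp (((-(t * ‖freq L n‖ ^ 2) : ℝ) : ℂ) * Complex.I) := by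
  rw [phase]; congr 1; push_cast; ring

theorem norm_phase (t : ℝ) (n : Fin 2 → ℤ) : ‖phase L t n‖ = 1 := by
  rw [phase_eq, Complex.norm_exp_ofReal_mul_I]

theorem phase_add (s t : ℝ) (n : Fin 2 → ℤ) : phase L (s + t) n = phase L s n * phase L t n := by
  rw [phase, phase, phase, ← Complex.exp_add]; congr 1; push_cast; ring

theorem phase_zero (n : Fin 2 → ℤ) : phase L 0 n = 1 := by simp [phase]

theorem continuous_phase (n : Fin 2 → ℤ) : Continuous fun t => phase L t n := by
  unfold phase; fun_prop

end Phase

section Basis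

variable (L : Fin 2 → ℝ) [∀ i, Fact (0 < L i)]

/-- The characters as elements of `L²`. -/
noncomputable abbrev characterLp (n : Fin 2 → ℤ) : L2 L :=
  ContinuousMap.toLp 2 (haar L) ℂ (character L n)

theorem coeFn_characterLp (n : Fin 2 → ℤ) : characterLp L n =ᵐ[haar L] character L n :=
  ContinuousMap.coeFn_toLp (haar L) (character L n)

/-- The integral of a product character factorises, and a direction in which the indices differ
contributes a vanishing factor. -/
theorem orthonormal_character : Orthonormal ℂ (characterLp L) := by
  rw [orthonormal_iff_ite]
  intro m n
  simp only [characterLp, ContinuousMap.inner_toLp, ← character_neg, ← character_add]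
  split_ifs with h
  · simp [h, character_zero]
  simp only [character_apply, haar]
  rw [MeasureTheory.integral_fintype_prod_eq_prod
    (f := fun i x => fourier ((n + -m) i) x)]
  obtain ⟨i, hi⟩ := Function.ne_iff.mp h
  apply Finset.prod_eq_zero (Finset.mem_univ i)
  simpa only [eq_false_intro hi, if_false, ContinuousMap.inner_toLp, ← fourier_neg,
    ← fourier_add] using! (orthonormal_iff_ite.mp <| orthonormal_fourier) (m i) (n i)

/-- The Hilbert basis of `L²` given by the characters. -/
noncomputable def characterBasis : HilbertBasis (Fin 2 → ℤ) ℂ (L2 L) :=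
  HilbertBasis.mk (orthonormal_character L) <| by
    have h := (ContinuousMap.toLp_denseRange ℂ (haar L) ℂ (p := 2)
      (by simp)).topologicalClosure_map_submodule
      (span_character_closure_eq_top (L := L) fun i => (Fact.out : 0 < L i).ne')
    simp only [Submodule.map_span, ContinuousLinearMap.coe_coe, ← range_comp,
      Function.comp_def] at h
    exact h.ge

theorem characterBasis_apply (n : Fin 2 → ℤ) : characterBasis L n = characterLp L n := by
  simp [characterBasis]

theorem coeff_eq_inner (f : L2 L) (n : Fin 2 → ℤ) : coeff L f n = inner ℂ (characterLp L n) f := by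
  rw [MeasureTheory.L2.inner_def, coeff]
  apply integral_congr_ae
  filter_upwards [coeFn_characterLp L n] with x hx
  rw [hx, RCLike.inner_apply, mul_comm]

theorem coeff_eq_repr (f : L2 L) (n : Fin 2 → ℤ) : coeff L f n = (characterBasis L).repr f n := by
  rw [HilbertBasis.repr_apply_apply, characterBasis_apply, coeff_eq_inner]

theorem hasSum_coeff (f : L2 L) : HasSum (fun n => coeff L f n • characterLp L n) f := by
  simpa only [coeff_eq_repr, characterBasis_apply] using (characterBasis L).hasSum_repr f

/-- The `n`-th coefficient as a continuous linear functional. -/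
noncomputable def coeffL (n : Fin 2 → ℤ) : L2 L →L[ℂ] ℂ := innerSL ℂ (characterLp L n)

theorem coeffL_apply (n : Fin 2 → ℤ) (f : L2 L) : coeffL L n f = coeff L f n := by
  simp [coeffL, coeff_eq_inner]

theorem coeff_sub (f g : L2 L) (n : Fin 2 → ℤ) :
    coeff L (f - g) n = coeff L f n - coeff L g n := by
  simp [← coeffL_apply]

theorem coeff_zero (n : Fin 2 → ℤ) : coeff L (0 : L2 L) n = 0 := by
  simp [← coeffL_apply]

theorem norm_coeff_le (f : L2 L) (n : Fin 2 → ℤ) : ‖coeff L f n‖ ≤ ‖f‖ := by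
  rw [coeff_eq_inner]
  refine (norm_inner_le_norm _ _).trans ?_
  rw [(orthonormal_character L).1 n, one_mul]

theorem ext_coeff {f g : L2 L} (h : ∀ n, coeff L f n = coeff L g n) : f = g := by
  apply (characterBasis L).repr.injective
  ext n
  simpa only [coeff_eq_repr] using h n

theorem hasSum_norm_coeff_sq (f : L2 L) : HasSum (fun n => ‖coeff L f n‖ ^ 2) (‖f‖ ^ 2) := by
  have h := (characterBasis L).hasSum_inner_mul_inner f f
  have h2 := RCLike.hasSum_re ℂ h
  rw [inner_self_eq_norm_sq] at h2
  convert! h2 using 2 with n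
  rw [characterBasis_apply, coeff_eq_inner, ← inner_conj_symm f, RCLike.conj_mul, ← RCLike.ofReal_pow,
    RCLike.ofReal_re]

theorem tsum_enorm_coeff_sq (f : L2 L) : ∑' n, ‖coeff L f n‖ₑ ^ 2 = ‖f‖ₑ ^ 2 := by
  have h := hasSum_norm_coeff_sq L f
  rw [← ofReal_norm, ← ENNReal.ofReal_pow (norm_nonneg _), ← h.tsum_eq,
    ENNReal.ofReal_tsum_of_nonneg (fun n => by positivity) h.summable]
  refine tsum_congr fun n => ?_
  rw [← ofReal_norm, ← ENNReal.ofReal_pow (norm_nonneg _)]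

/-- Riesz–Fischer: square summable sequences are coefficients. -/
theorem summable_smul_characterLp {c : (Fin 2 → ℤ) → ℂ} (hc : Summable fun n => ‖c n‖ ^ 2) :
    Summable (fun n => c n • characterLp L n) ∧
      ∀ n, coeff L (∑' n, c n • characterLp L n) n = c n := by
  have hm : Memℓp c 2 := by
    rw [memℓp_gen_iff (by norm_num)]
    simpa using hc
  have h := (characterBasis L).hasSum_repr_symm ⟨c, hm⟩
  simp only [characterBasis_apply] at h
  refine ⟨h.summable, fun n => ?_⟩
  rw [h.tsum_eq, coeff_eq_repr, LinearIsometryEquiv.apply_symm_apply]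

theorem coeff_multiplier {m : (Fin 2 → ℤ) → ℂ} {K : ℝ} (hm : ∀ n, ‖m n‖ ≤ K) (f : L2 L)
    (n : Fin 2 → ℤ) : coeff L (multiplier L m f) n = m n * coeff L f n := by
  refine (summable_smul_characterLp L (c := fun n => m n * coeff L f n) ?_).2 n
  refine Summable.of_nonneg_of_le (fun n => by positivity) (fun n => ?_)
    ((hasSum_norm_coeff_sq L f).summable.mul_left (K ^ 2))
  rw [norm_mul, mul_pow]
  gcongr
  exact hm n

theorem coeff_schr (t : ℝ) (f : L2 L) (n : Fin 2 → ℤ) :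
    coeff L (schr L t f) n = phase L t n * coeff L f n :=
  coeff_multiplier L (fun n => (norm_phase L t n).le) f n

theorem norm_schr (t : ℝ) (f : L2 L) : ‖schr L t f‖ = ‖f‖ := by
  have h := hasSum_norm_coeff_sq L (schr L t f)
  simp only [coeff_schr, norm_mul, norm_phase, one_mul] at h
  exact (pow_left_inj₀ (norm_nonneg _) (norm_nonneg _) two_ne_zero).1
    (h.unique (hasSum_norm_coeff_sq L f))

/-- An `L²`-valued function with measurable coefficients is strongly measurable. -/
theorem aestronglyMeasurable_of_coeff {α : Type*} [MeasurableSpace α] {μ : Measure α}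
    {H : α → L2 L} (h : ∀ n, AEStronglyMeasurable (fun t => coeff L (H t) n) μ) :
    AEStronglyMeasurable H μ := by
  refine aestronglyMeasurable_of_tendsto_ae (u := (atTop : Filter (Finset (Fin 2 → ℤ))))
    (f := fun s t => ∑ n ∈ s, coeff L (H t) n • characterLp L n) (fun s => ?_)
    (ae_of_all _ fun t => hasSum_coeff L (H t))
  exact Finset.aestronglyMeasurable_fun_sum s fun n _ => (h n).smul_const _

theorem aestronglyMeasurable_coeff {α : Type*} [MeasurableSpace α] {μ : Measure α}
    {H : α → L2 L} (h : AEStronglyMeasurable H μ) (n : Fin 2 → ℤ) :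
    AEStronglyMeasurable (fun t => coeff L (H t) n) μ := by
  simpa only [coeffL_apply] using (coeffL L n).continuous.comp_aestronglyMeasurable h

/-- The Fourier coefficient of a function. -/
noncomputable def fcoef (F : Torus L → ℂ) (n : Fin 2 → ℤ) : ℂ :=
  ∫ x, conj (character L n x) * F x ∂(haar L)

variable {L}

theorem fcoef_congr_ae {F G : Torus L → ℂ} (h : F =ᵐ[haar L] G) (n : Fin 2 → ℤ) :
    fcoef L F n = fcoef L G n := by
  apply integral_congr_ae
  filter_upwards [h] with x hx
  rw [hx]

theorem coeff_toLp {F : Torus L → ℂ} (hF : MemLp F 2 (haar L)) (n : Fin 2 → ℤ) :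
    coeff L (hF.toLp F) n = fcoef L F n := fcoef_congr_ae hF.coeFn_toLp n

theorem toL2_eq {F : Torus L → ℂ} (hF : MemLp F 2 (haar L)) : toL2 L F = hF.toLp F := by
  rw [toL2, dif_pos hF]

theorem coeff_toL2 {F : Torus L → ℂ} (hF : MemLp F 2 (haar L)) (n : Fin 2 → ℤ) :
    coeff L (toL2 L F) n = fcoef L F n := by
  rw [toL2_eq hF, coeff_toLp]

theorem enorm_sq_eq_lintegral (f : L2 L) : ‖f‖ₑ ^ 2 = ∫⁻ x, ‖f x‖ₑ ^ 2 ∂(haar L) := by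
  rw [Lp.enorm_def, eLpNorm_eq_lintegral_rpow_enorm_toReal (by norm_num) (by norm_num),
    ← ENNReal.rpow_natCast, ← ENNReal.rpow_mul]
  simp

/-- Parseval's identity for functions. -/
theorem lintegral_enorm_sq_eq_tsum {F : Torus L → ℂ} (hF : MemLp F 2 (haar L)) :
    ∫⁻ x, ‖F x‖ₑ ^ 2 ∂(haar L) = ∑' n, ‖fcoef L F n‖ₑ ^ 2 := by
  simp only [← coeff_toLp hF]
  rw [tsum_enorm_coeff_sq, enorm_sq_eq_lintegral]
  apply lintegral_congr_ae
  filter_upwards [hF.coeFn_toLp] with x hx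
  rw [hx]

theorem integrable_conj_character_mul {F : Torus L → ℂ} (hF : MemLp F 2 (haar L))
    (n : Fin 2 → ℤ) : Integrable (fun x => conj (character L n x) * F x) (haar L) := by
  have h1 : Integrable F (haar L) := hF.integrable one_le_two
  refine h1.bdd_mul (c := 1) ?_ ?_
  · exact (Complex.continuous_conj.comp (character L n).continuous).aestronglyMeasurable
  · exact ae_of_all _ fun x => by simp [norm_character]

theorem fcoef_sub {F G : Torus L → ℂ} (hF : MemLp F 2 (haar L)) (hG : MemLp G 2 (haar L))
    (n : Fin 2 → ℤ) : fcoef L (fun x => F x - G x) n = fcoef L F n - fcoef L G n := by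
  simp only [fcoef, mul_sub]
  exact integral_sub (integrable_conj_character_mul hF n) (integrable_conj_character_mul hG n)

theorem fcoef_character_mul (k : Fin 2 → ℤ) (F : Torus L → ℂ) (n : Fin 2 → ℤ) :
    fcoef L (fun x => character L k x * F x) n = fcoef L F (n - k) := by
  simp only [fcoef]
  congr 1; ext x
  rw [← mul_assoc, ← character_neg, ← character_neg, ← character_add]
  congr 3
  abel

theorem fcoef_conj (F : Torus L → ℂ) (n : Fin 2 → ℤ) :
    fcoef L (fun x => conj (F x)) n = conj (fcoef L F (-n)) := by
  simp only [fcoef, ← integral_conj, map_mul, character_neg, Complex.conj_conj]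

instance : (haar L).IsAddLeftInvariant := by
  unfold haar; infer_instance

theorem fcoef_translate (F : Torus L → ℂ) (y : Torus L) (n : Fin 2 → ℤ) :
    fcoef L (fun x => F (x + y)) n = character L n y * fcoef L F n := by
  have h : fcoef L F n = ∫ x, conj (character L n (x + y)) * F (x + y) ∂(haar L) :=
    (integral_add_right_eq_self (μ := haar L) (fun x => conj (character L n x) * F x) y).symm
  have h2 : character L n y * conj (character L n y) = 1 := by
    rw [Complex.mul_conj, Complex.normSq_eq_norm_sq, norm_character]; simp
  rw [h, fcoef, ← integral_const_mul]
  congr 1; ext x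
  rw [character_add_arg, map_mul]
  linear_combination (-(conj (character L n x) * F (x + y))) * h2

theorem memLp_translate {F : Torus L → ℂ} (hF : MemLp F 2 (haar L)) (y : Torus L) :
    MemLp (fun x => F (x + y)) 2 (haar L) :=
  hF.comp_measurePreserving (measurePreserving_add_right (haar L) y)

end Basis

/-! ### A bound for the `U²` norm of absolutely continuous functions -/

/-- The step function on `[-a, ∞)` with value `ψ j` on the `j`-th of `M` intervals of equal length
that make up `[-a, a)`, and value `ψ M` on `[a, ∞)`. -/
noncomputable def gridStep (a : ℝ) (M : ℕ) (ψ : ℕ → ℂ) (t : ℝ) : ℂ :=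
  if t < -a then 0 else ψ (min ⌊(t + a) / (2 * a) * M⌋₊ M)

/-- The partition of the atom is shifted by one against the grid: the interval with index 0 is (-∞,
-a) with value 0, the grid points follow with indices 1 to M + 1, and all later times are `⊤`. -/
theorem isU2Atom_gridStep {a : ℝ} (ha : 0 < a) {M : ℕ} (hM : 0 < M) {ψ : ℕ → ℂ}
    (hψ : ∑ j ∈ Finset.range (M + 1), ‖ψ j‖ ^ 2 = 1) : IsU2Atom (gridStep a M ψ) := by
  have hM' : (0 : ℝ) < M := by exact_mod_cast hM
  let t : ℕ → EReal := fun k => Nat.casesOn k ⊥ fun k =>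
    if k ≤ M then ((-a + 2 * a * k / M : ℝ) : EReal) else ⊤
  let φ : ℕ → ℂ := fun k => Nat.casesOn k 0 fun k => if k ≤ M then ψ k else 0
  have t0 : t 0 = ⊥ := rfl
  have ts : ∀ k, t (k + 1) = if k ≤ M then ((-a + 2 * a * k / M : ℝ) : EReal) else ⊤ :=
    fun k => rfl
  have φ0 : φ 0 = 0 := rfl
  have φs : ∀ k, φ (k + 1) = if k ≤ M then ψ k else 0 := fun k => rfl
  refine ⟨t, φ, t0, ?_, ?_, ?_, ?_, ?_⟩
  · rintro (_ | k)
    · left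
      rw [t0, ts, if_pos (Nat.zero_le _)]
      exact EReal.bot_lt_coe _
    · rw [ts, ts]
      by_cases h1 : k + 1 ≤ M
      · left
        rw [if_pos h1, if_pos (by omega), EReal.coe_lt_coe_iff]
        push_cast
        gcongr
        simp
      · rw [if_neg h1]
        by_cases h2 : k ≤ M
        · left; rw [if_pos h2]; exact EReal.coe_lt_top _
        · right; simp [h2]
  · rintro (_ | k)
    · intro h; rw [t0] at h; simp at h
    · intro h
      rw [ts] at h
      rw [φs]
      by_cases h2 : k ≤ M
      · rw [if_pos h2] at h; exact absurd h (EReal.coe_ne_top _)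
      · rw [if_neg h2]
  · have h : ∑ k ∈ Finset.range (M + 2), ‖φ k‖ ^ 2 = 1 := by
      rw [Finset.sum_range_succ', φ0, ← hψ]
      simp only [norm_zero, ne_eq, OfNat.ofNat_ne_zero, not_false_eq_true, zero_pow, add_zero]
      refine Finset.sum_congr rfl fun k hk => ?_
      rw [φs, if_pos (by simpa [Nat.lt_succ_iff] using hk)]
    rw [← h]
    refine hasSum_sum_of_ne_finset_zero fun k hk => ?_
    rcases k with _ | k
    · simp at hk
    · rw [φs, if_neg]
      · simp
      · simp at hk; omega
  · rintro (_ | k) s h1 h2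
    · rw [ts, if_pos (Nat.zero_le _), EReal.coe_lt_coe_iff] at h2
      rw [gridStep, if_pos (by simpa using h2), φ0]
    · rw [ts] at h1 h2
      rw [φs]
      by_cases hk : k ≤ M
      · rw [if_pos hk, EReal.coe_le_coe_iff] at h1
        have hk0 : (k : ℝ) ≤ (s + a) / (2 * a) * M := by
          have : 2 * a * k / M ≤ s + a := by linarith
          rw [div_le_iff₀ hM'] at this
          rw [div_mul_eq_mul_div, le_div_iff₀ (by positivity)]
          linarith
        have hs : ¬ s < -a := by
          have : (0 : ℝ) ≤ 2 * a * k / M := by positivity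
          linarith
        have hfl : k ≤ ⌊(s + a) / (2 * a) * M⌋₊ := Nat.le_floor hk0
        rw [gridStep, if_neg hs, if_pos hk]
        congr 1
        by_cases hk1 : k + 1 ≤ M
        · rw [if_pos hk1, EReal.coe_lt_coe_iff] at h2
          have : (s + a) / (2 * a) * M < (k + 1 : ℕ) := by
            have : s + a < 2 * a * (k + 1 : ℕ) / M := by linarith
            rw [lt_div_iff₀ hM'] at this
            rw [div_mul_eq_mul_div, div_lt_iff₀ (by positivity)]
            linarith
          have := (Nat.floor_lt' (by omega)).2 this
          omega
        · omega
      · rw [if_neg hk] at h1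
        exact absurd (top_le_iff.1 h1) (EReal.coe_ne_top _)
  · intro s hs
    have := hs (M + 2)
    rw [ts, if_neg (by omega)] at this
    exact absurd (top_le_iff.1 this) (EReal.coe_ne_top _)

theorem exists_atom_gridStep {a : ℝ} (ha : 0 < a) {M : ℕ} (hM : 0 < M) (ψ : ℕ → ℂ) :
    ∃ A : ℝ → ℂ, IsU2Atom A ∧ ∀ t, gridStep a M ψ t =
      (√(∑ j ∈ Finset.range (M + 1), ‖ψ j‖ ^ 2) : ℂ) * A t := by
  set S := ∑ j ∈ Finset.range (M + 1), ‖ψ j‖ ^ 2 with hS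
  have hS0 : 0 ≤ S := Finset.sum_nonneg fun j _ => by positivity
  rcases hS0.eq_or_lt with h | h
  -- All values vanish, so any atom will do with coefficient zero.
  · refine ⟨_, isU2Atom_gridStep ha hM (ψ := fun j => if j = 0 then 1 else 0) ?_, fun t => ?_⟩
    · rw [Finset.sum_eq_single 0] <;> simp +contextual
    · rw [← h, Real.sqrt_zero, Complex.ofReal_zero, zero_mul, gridStep]
      split_ifs with h1
      · rfl
      · have h3 := (Finset.sum_eq_zero_iff_of_nonneg (fun j _ => by positivity)).1 (hS.symm.trans h.symm)
          (min ⌊(t + a) / (2 * a) * M⌋₊ M) (by simp)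
        simpa using h3
  · have h1 : 0 < √S := Real.sqrt_pos.2 h
    refine ⟨_, isU2Atom_gridStep ha hM (ψ := fun j => ψ j / (√S : ℂ)) ?_, fun t => ?_⟩
    · simp only [norm_div, div_pow, ← Finset.sum_div, Complex.norm_real, Real.norm_eq_abs, sq_abs]
      rw [Real.sq_sqrt hS0, div_self h.ne']
    · have h2 : (√S : ℂ) ≠ 0 := by exact_mod_cast h1.ne'
      simp only [gridStep]
      split_ifs
      · simp
      · field_simp

theorem norm_gridStep_le (a : ℝ) (M : ℕ) (ψ : ℕ → ℂ) (t : ℝ) :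
    ‖gridStep a M ψ t‖ ≤ √(∑ j ∈ Finset.range (M + 1), ‖ψ j‖ ^ 2) := by
  rw [gridStep]
  split_ifs
  · simp
  · apply Real.le_sqrt_of_sq_le
    exact Finset.single_le_sum (f := fun j => ‖ψ j‖ ^ 2) (fun j _ => by positivity) (by simp)

/-- If `g` is a sum of step functions with summable `ℓ²` norms, then it has finite `U²` norm. -/
theorem u2Norm_le_of_hasSum_gridStep {a : ℝ} (ha : 0 < a) {M : ℕ → ℕ} (hM : ∀ k, 0 < M k)
    {ψ : ℕ → ℕ → ℂ} {b : ℕ → ℝ} {s : ℝ} (hb : HasSum b s)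
    (hψ : ∀ k, √(∑ j ∈ Finset.range (M k + 1), ‖ψ k j‖ ^ 2) ≤ b k) {g : ℝ → ℂ}
    (hg : ∀ t, HasSum (fun k => gridStep a (M k) (ψ k) t) (g t)) :
    u2Norm g ≤ ENNReal.ofReal s := by
  choose A hA hA' using fun k => exists_atom_gridStep ha (hM k) (ψ k)
  have hsum : Summable fun k => √(∑ j ∈ Finset.range (M k + 1), ‖ψ k j‖ ^ 2) :=
    Summable.of_nonneg_of_le (fun k => Real.sqrt_nonneg _) hψ hb.summable
  unfold u2Norm
  refine iInf_le_of_le (fun k => (√(∑ j ∈ Finset.range (M k + 1), ‖ψ k j‖ ^ 2) : ℂ)) <|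
    iInf_le_of_le A <| iInf_le_of_le hA <| iInf_le_of_le ?_ <|
    iInf_le_of_le (fun t => by simpa only [hA'] using hg t) ?_
  · simpa only [Complex.norm_real, Real.norm_eq_abs, abs_of_nonneg (Real.sqrt_nonneg _)] using hsum
  · rw [← hb.tsum_eq, ENNReal.ofReal_tsum_of_nonneg
      (fun k => (Real.sqrt_nonneg _).trans (hψ k)) hb.summable]
    refine ENNReal.tsum_le_tsum fun k => ?_
    rw [← ofReal_norm, Complex.norm_real, Real.norm_eq_abs, abs_of_nonneg (Real.sqrt_nonneg _)]
    exact ENNReal.ofReal_le_ofReal (hψ k)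

/-- Cauchy–Schwarz, obtained from the nonnegativity of the variance of q about its mean m. -/
theorem sq_integral_le {x y : ℝ} (hxy : x ≤ y) {q : ℝ → ℝ} (hq : IntervalIntegrable q volume x y)
    (hq2 : IntervalIntegrable (fun s => q s ^ 2) volume x y) :
    (∫ s in x..y, q s) ^ 2 ≤ (y - x) * ∫ s in x..y, q s ^ 2 := by
  rcases hxy.eq_or_lt with rfl | h
  · simp
  set m := (∫ s in x..y, q s) / (y - x) with hm
  have hd : 0 < y - x := sub_pos.2 h
  have h1 : 0 ≤ ∫ s in x..y, (q s - m) ^ 2 :=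
    intervalIntegral.integral_nonneg hxy fun s _ => sq_nonneg _
  have h2 : ∫ s in x..y, (q s - m) ^ 2 =
      (∫ s in x..y, q s ^ 2) - 2 * m * (∫ s in x..y, q s) + (y - x) * m ^ 2 := by
    have : ∀ s, (q s - m) ^ 2 = q s ^ 2 - 2 * m * q s + m ^ 2 := fun s => by ring
    simp only [this]
    rw [intervalIntegral.integral_add (hq2.sub (hq.const_mul _)) (by simp),
      intervalIntegral.integral_sub hq2 (hq.const_mul _), intervalIntegral.integral_const_mul]
    simp
  have h3 : m * (y - x) = ∫ s in x..y, q s := by rw [hm]; field_simp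
  rw [h2, ← h3] at h1
  rw [← h3]
  nlinarith

theorem norm_integral_sq_le {x y : ℝ} (hxy : x ≤ y) {p : ℝ → ℂ} (hp : Integrable p)
    (hp2 : Integrable fun s => ‖p s‖ ^ 2) :
    ‖∫ s in x..y, p s‖ ^ 2 ≤ (y - x) * ∫ s in x..y, ‖p s‖ ^ 2 := by
  refine le_trans ?_ (sq_integral_le hxy hp.norm.intervalIntegrable hp2.intervalIntegrable)
  gcongr
  exact intervalIntegral.norm_integral_le_integral_norm hxy

/-- A primitive of a square integrable function supported in `[-a, a]` has `U²` norm bounded by the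
`L²` norm of its derivative. -/
theorem u2Norm_primitive_le {a : ℝ} (ha : 0 < a) {p G : ℝ → ℂ} (hp : Integrable p)
    (hp2 : Integrable fun s => ‖p s‖ ^ 2) (hsupp : ∀ t, a < |t| → p t = 0)
    (hG : ∀ s t, G t - G s = ∫ x in s..t, p x) (hGa : G (-a) = 0) :
    u2Norm G ≤ ENNReal.ofReal (4 * √(2 * a * ∫ s, ‖p s‖ ^ 2)) := by
  set A := ∫ s, ‖p s‖ ^ 2 with hA
  have hA0 : 0 ≤ A := integral_nonneg fun s => by positivity
  have hGcont : Continuous G := by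
    have : G = fun t => G 0 + ∫ x in (0 : ℝ)..t, p x := by
      ext t; rw [← hG]; ring
    rw [this]
    exact continuous_const.add (intervalIntegral.continuous_primitive
      (fun x y => hp.intervalIntegrable) 0)
  have hGleft : ∀ t, t < -a → G t = 0 := by
    intro t ht
    have h := hG t (-a)
    rw [hGa, intervalIntegral.integral_of_le ht.le, integral_Ioc_eq_integral_Ioo,
      setIntegral_eq_zero_of_forall_eq_zero] at h
    · simpa using h
    · intro x hx
      refine hsupp x ?_
      rw [lt_abs]; right; linarith [hx.2]
  have hGright : ∀ t, a ≤ t → G t = G a := by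
    intro t ht
    have h := hG a t
    rw [intervalIntegral.integral_of_le ht, setIntegral_eq_zero_of_forall_eq_zero] at h
    · exact sub_eq_zero.1 h
    · intro x hx
      refine hsupp x ?_
      rw [lt_abs]; left; exact hx.1
  let X : ℕ → ℕ → ℝ := fun k j => -a + 2 * a * (j / 2 ^ k)
  -- Level k corrects the sampling of G on the grid of mesh 2a/2^k only at the odd points, which are
  -- the ones absent from the coarser grid. The partial sums therefore telescope to the sampled
  -- function itself.
  let ψ : ℕ → ℕ → ℂ := fun k j => if Odd j then G (X k j) - G (X k (j - 1)) else 0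
  have hXsucc : ∀ k j, X k (j + 1) - X k j = 2 * a / 2 ^ k := by
    intro k j; simp only [X]; push_cast; field_simp; ring
  have hXmono : ∀ k j, X k j ≤ X k (j + 1) := by
    intro k j
    have : 0 ≤ 2 * a / 2 ^ k := by positivity
    linarith [hXsucc k j]
  have hψsum : ∀ k, ∑ j ∈ Finset.range (2 ^ k + 1), ‖ψ k j‖ ^ 2 ≤ 2 * a / 2 ^ k * A := by
    intro k
    rw [Finset.sum_range_succ']
    have h0 : ψ k 0 = 0 := by simp [ψ]
    have h1 : ∀ j, ‖ψ k (j + 1)‖ ^ 2 ≤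
        2 * a / 2 ^ k * ∫ s in X k j..X k (j + 1), ‖p s‖ ^ 2 := by
      intro j
      have hint : 0 ≤ ∫ s in X k j..X k (j + 1), ‖p s‖ ^ 2 :=
        intervalIntegral.integral_nonneg (hXmono k j) fun s _ => by positivity
      simp only [ψ]
      split_ifs
      · rw [Nat.add_sub_cancel, hG, ← hXsucc k j]
        exact norm_integral_sq_le (hXmono k j) hp hp2
      · simp only [norm_zero, ne_eq, OfNat.ofNat_ne_zero, not_false_eq_true, zero_pow]
        positivity
    rw [h0]
    simp only [norm_zero, ne_eq, OfNat.ofNat_ne_zero, not_false_eq_true, zero_pow, add_zero]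
    refine (Finset.sum_le_sum fun j _ => h1 j).trans ?_
    rw [← Finset.mul_sum, intervalIntegral.sum_integral_adjacent_intervals
      (fun j _ => hp2.intervalIntegrable)]
    gcongr
    have hle : X k 0 ≤ X k (2 ^ k) := monotone_nat_of_le_succ (hXmono k) (Nat.zero_le _)
    rw [intervalIntegral.integral_of_le hle]
    exact setIntegral_le_integral hp2 (ae_of_all _ fun s => by positivity)
  let c : ℝ := √(2 * a * A)
  -- The true ratio of decay is 1/√2; the rational 3/4 lies above it and has geometric sum 4.
  have hb : HasSum (fun k : ℕ => c * (3 / 4 : ℝ) ^ k) (4 * √(2 * a * A)) := by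
    have := (hasSum_geometric_of_lt_one (r := (3 / 4 : ℝ)) (by norm_num) (by norm_num)).mul_left c
    convert! this using 1
    simp only [c]; norm_num; ring
  have hcoef : ∀ k, √(∑ j ∈ Finset.range (2 ^ k + 1), ‖ψ k j‖ ^ 2) ≤ c * (3 / 4 : ℝ) ^ k := by
    intro k
    refine Real.sqrt_le_iff.2 ⟨by positivity, ?_⟩
    · refine (hψsum k).trans ?_
      rw [mul_pow, Real.sq_sqrt (by positivity), ← pow_mul, mul_comm k 2, pow_mul]
      have : (1 / 2 : ℝ) ^ k ≤ ((3 / 4) ^ 2) ^ k := by gcongr; norm_num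
      calc 2 * a / 2 ^ k * A = 2 * a * A * (1 / 2) ^ k := by rw [one_div, inv_pow]; ring
        _ ≤ _ := by gcongr
  refine u2Norm_le_of_hasSum_gridStep ha (M := fun k => 2 ^ k) (fun k => by positivity) hb hcoef ?_
  intro t
  have hsm : Summable fun k => gridStep a (2 ^ k) (ψ k) t :=
    Summable.of_norm_bounded hb.summable fun k => (norm_gridStep_le _ _ _ _).trans (hcoef k)
  let g : ℕ → ℂ := fun k => gridStep a (2 ^ k) (fun j => G (X k j)) t
  have hpart : ∀ K, ∑ k ∈ Finset.range (K + 1), gridStep a (2 ^ k) (ψ k) t = g K := by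
    intro K
    induction K with
    | zero =>
      simp only [zero_add, Finset.range_one, Finset.sum_singleton, g, gridStep]
      split_ifs with ht
      · rfl
      · have : min ⌊(t + a) / (2 * a) * ((2 ^ 0 : ℕ) : ℝ)⌋₊ (2 ^ 0) = 0 ∨
            min ⌊(t + a) / (2 * a) * ((2 ^ 0 : ℕ) : ℝ)⌋₊ (2 ^ 0) = 1 := by
          rw [pow_zero]; omega
        rcases this with h | h <;> rw [h] <;> simp [ψ, X, hGa]
    | succ K ih =>
      rw [Finset.sum_range_succ, ih]
      simp only [g, gridStep]
      split_ifs with ht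
      · simp
      · set r := (t + a) / (2 * a) with hr
        set m := min ⌊r * ((2 ^ (K + 1) : ℕ) : ℝ)⌋₊ (2 ^ (K + 1)) with hm
        -- The coarse cell containing t has half the index of the fine one, rounded down; the
        -- truncation at the last grid point is compatible with this.
        have hm' : min ⌊r * ((2 ^ K : ℕ) : ℝ)⌋₊ (2 ^ K) = m / 2 := by
          have : r * ((2 ^ K : ℕ) : ℝ) = r * ((2 ^ (K + 1) : ℕ) : ℝ) / (2 : ℕ) := by
            push_cast; rw [pow_succ]; ring
          rw [this, Nat.floor_div_natCast, hm, pow_succ]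
          omega
        rw [hm']
        have hX2 : ∀ j, X (K + 1) (2 * j) = X K j := by
          intro j; simp only [X]; push_cast; rw [pow_succ]; field_simp
        rw [← hX2 (m / 2)]
        by_cases hodd : Odd m
        · simp only [ψ, if_pos hodd]
          rw [show 2 * (m / 2) = m - 1 by obtain ⟨q, hq⟩ := hodd; omega]
          ring
        · simp only [ψ, if_neg hodd]
          rw [Nat.not_odd_iff_even] at hodd
          rw [show 2 * (m / 2) = m by obtain ⟨q, hq⟩ := hodd; omega]
          ring
  have hlim : Tendsto g atTop (𝓝 (G t)) := by
    simp only [g, gridStep]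
    split_ifs with ht
    · rw [hGleft t ht]; exact tendsto_const_nhds
    · set r := (t + a) / (2 * a) with hr
      have hr0 : 0 ≤ r := by
        rw [hr]; apply div_nonneg <;> linarith
      have h2 : Tendsto (fun k : ℕ => (2 : ℝ) ^ k) atTop atTop :=
        tendsto_pow_atTop_atTop_of_one_lt (by norm_num)
      have h3 : Tendsto (fun k : ℕ => ((min ⌊r * ((2 ^ k : ℕ) : ℝ)⌋₊ (2 ^ k) : ℕ) : ℝ) / 2 ^ k)
          atTop (𝓝 (min r 1)) := by
        have := ((tendsto_nat_floor_mul_div_atTop hr0).comp h2).min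
          (tendsto_const_nhds (x := (1 : ℝ)))
        refine this.congr fun k => ?_
        have h2k : (0 : ℝ) < 2 ^ k := by positivity
        simp only [Function.comp_apply]
        push_cast
        rw [← min_div_div_right h2k.le, div_self h2k.ne']
      -- The samples converge to t inside the window and to the endpoint a beyond it, where G is
      -- constant.
      have h4 : G (-a + 2 * a * min r 1) = G t := by
        rcases le_total r 1 with h | h
        · rw [min_eq_left h, hr]
          congr 1
          field_simp
          ring
        · rw [min_eq_right h, hGright t]
          · congr 1; ring
          · rw [hr, le_div_iff₀ (by positivity)] at h; linarith
      rw [← h4]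
      exact (hGcont.tendsto _).comp ((h3.const_mul (2 * a)).const_add (-a))
  have h5 := (hsm.hasSum.tendsto_sum_nat).comp (tendsto_add_atTop_nat 1)
  have h6 : Tendsto (fun K => ∑ k ∈ Finset.range (K + 1), gridStep a (2 ^ k) (ψ k) t) atTop
      (𝓝 (G t)) := by simpa only [hpart] using hlim
  rw [← tendsto_nhds_unique h5 h6]
  exact hsm.hasSum

/-! ### The Duhamel integral in `X^{1/2}` -/

section Duhamel

variable (L : Fin 2 → ℝ) [∀ i, Fact (0 < L i)]

/-- Unitarity gives the bound, and measurability is checked coefficient by coefficient, where the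
propagator is a continuous phase. -/
theorem integrable_schr_sub {H : ℝ → L2 L} (hH : Integrable H) (t : ℝ) :
    Integrable fun s => schr L (t - s) (H s) := by
  refine Integrable.mono hH (aestronglyMeasurable_of_coeff L fun n => ?_)
    (ae_of_all _ fun s => (norm_schr L _ _).le)
  simp only [coeff_schr]
  exact ((continuous_phase L n).comp (continuous_const.sub continuous_id)).aestronglyMeasurable.mul
    (aestronglyMeasurable_coeff L hH.1 n)

theorem integrable_coeff {H : ℝ → L2 L} (hH : Integrable H) (n : Fin 2 → ℤ) :
    Integrable fun s => coeff L (H s) n := by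
  simpa only [coeffL_apply] using (coeffL L n).integrable_comp hH

theorem integrable_phase_mul_coeff {H : ℝ → L2 L} (hH : Integrable H) (n : Fin 2 → ℤ) :
    Integrable fun s => phase L (-s) n * coeff L (H s) n := by
  refine (integrable_coeff L hH n).bdd_mul (c := 1) ?_ (ae_of_all _ fun s => (norm_phase L _ n).le)
  exact ((continuous_phase L n).comp continuous_neg).aestronglyMeasurable

/-- Pulling the phase at time t out of the integral leaves a scalar primitive, to which the U² bound
applies. -/
theorem coeff_duhamel {H : ℝ → L2 L} (hH : Integrable H) (t : ℝ) (n : Fin 2 → ℤ) :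
    coeff L (duhamel L (-1) H t) n =
      phase L t n * ∫ s in (-1 : ℝ)..t, phase L (-s) n * coeff L (H s) n := by
  rw [duhamel, ← coeffL_apply, ← ContinuousLinearMap.intervalIntegral_comp_comm _
    (integrable_schr_sub L hH t).intervalIntegrable, ← intervalIntegral.integral_const_mul]
  congr 1; ext s
  rw [coeffL_apply, coeff_schr, sub_eq_add_neg, phase_add, mul_assoc]

/-- The `X^{1/2}` norm of a Duhamel integral with short time support, estimated by the
`L²_t H^{1/2}` norm of the inhomogeneity. -/
theorem xNorm_duhamel_le {a : ℝ} (ha : 0 < a) (ha1 : a < 1) {H : ℝ → L2 L} (hH : Integrable H)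
    (hH2 : Integrable fun s => ‖H s‖ ^ 2) (hsupp : ∀ t, a < |t| → H t = 0) {E : ℝ≥0∞}
    (hE : ∑' n, ENNReal.ofReal ((1 + ‖freq L n‖ ^ 2) ^ (1 / 2 : ℝ)) *
      ∫⁻ s, ‖coeff L (H s) n‖ₑ ^ 2 ≤ E) (hE' : E ≠ ∞) {u : ℝ → L2 L}
    (hu : EqOn u (duhamel L (-1) H) (Ioo (-1) 1)) :
    xNorm L (1 / 2) (Ioo (-1) 1) u ≤ (ENNReal.ofReal (32 * a) * E) ^ (1 / 2 : ℝ) := by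
  set w : (Fin 2 → ℤ) → ℝ≥0∞ := fun n => ENNReal.ofReal ((1 + ‖freq L n‖ ^ 2) ^ (1 / 2 : ℝ)) with hw
  set p : (Fin 2 → ℤ) → ℝ → ℂ := fun n s => phase L (-s) n * coeff L (H s) n with hp
  set G : (Fin 2 → ℤ) → ℝ → ℂ := fun n t => ∫ s in (-1 : ℝ)..t, p n s with hG
  set A : (Fin 2 → ℤ) → ℝ := fun n => ∫ s, ‖p n s‖ ^ 2 with hA
  have hpint : ∀ n, Integrable (p n) := fun n => integrable_phase_mul_coeff L hH n
  have hpnorm : ∀ n s, ‖p n s‖ = ‖coeff L (H s) n‖ := fun n s => by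
    simp only [hp, norm_mul, norm_phase, one_mul]
  have hpint2 : ∀ n, Integrable fun s => ‖p n s‖ ^ 2 := fun n => by
    refine Integrable.mono' hH2 ((hpint n).1.norm.pow 2) (ae_of_all _ fun s => ?_)
    rw [Real.norm_of_nonneg (by positivity), hpnorm]
    gcongr
    exact norm_coeff_le L _ n
  have hAeq : ∀ n, ENNReal.ofReal (A n) = ∫⁻ s, ‖coeff L (H s) n‖ₑ ^ 2 := fun n => by
    rw [hA, ofReal_integral_eq_lintegral_ofReal (hpint2 n) (ae_of_all _ fun s => by positivity)]
    congr 1; ext s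
    rw [hpnorm, ENNReal.ofReal_pow (norm_nonneg _), ofReal_norm]
  have hwA : ∑' n, w n * ENNReal.ofReal (A n) ≤ E := by simpa only [hAeq] using hE
  have hGcont : ∀ n, Continuous (G n) := fun n =>
    intervalIntegral.continuous_primitive (fun x y => (hpint n).intervalIntegrable) _
  have hA0 : ∀ n, 0 ≤ A n := fun n => integral_nonneg fun s => by positivity
  have hGbound : ∀ n, ∀ t ∈ Ioo (-1 : ℝ) 1, ‖G n t‖ ^ 2 ≤ 2 * A n := by
    intro n t ht
    refine (norm_integral_sq_le ht.1.le (hpint n) (hpint2 n)).trans ?_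
    have h1 : ∫ s in (-1 : ℝ)..t, ‖p n s‖ ^ 2 ≤ A n := by
      rw [intervalIntegral.integral_of_le ht.1.le]
      exact setIntegral_le_integral (hpint2 n) (ae_of_all _ fun s => by positivity)
    exact mul_le_mul (by linarith [ht.2]) h1
      (intervalIntegral.integral_nonneg ht.1.le fun s _ => by positivity) (by norm_num)
  have hcoef : ∀ t n, coeff L (duhamel L (-1) H t) n = phase L t n * G n t :=
    fun t n => coeff_duhamel L hH t n
  have hcont : ContInH L (1 / 2) (Ioo (-1) 1) u := by
    intro t ht
    constructor
    · rw [hNorm]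
      refine ENNReal.rpow_lt_top_of_nonneg (by norm_num) (ne_of_lt ?_)
      refine lt_of_le_of_lt (b := 2 * E) ?_ (ENNReal.mul_lt_top (by simp) hE'.lt_top)
      refine le_trans ?_ (mul_le_mul_right hwA 2)
      rw [← ENNReal.tsum_mul_left]
      refine ENNReal.tsum_le_tsum fun n => ?_
      rw [hu ht, hcoef, mul_left_comm]
      refine mul_le_mul_right ?_ _
      rw [← ofReal_norm, ← ENNReal.ofReal_pow (norm_nonneg _), norm_mul, norm_phase, one_mul]
      refine (ENNReal.ofReal_le_ofReal (hGbound n t ht)).trans_eq ?_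
      rw [ENNReal.ofReal_mul (by norm_num)]; simp
    · have key : Tendsto (fun r => ∑' n, w n * ‖coeff L (u r - u t) n‖ₑ ^ 2)
          (𝓝[Ioo (-1) 1] t) (𝓝 0) := by
        -- Continuity in H^{1/2} is dominated convergence for the counting measure on frequencies:
        -- each coefficient is continuous in time, and 8 A n dominates the square of its increment.
        have hdc := tendsto_lintegral_filter_of_dominated_convergence
          (μ := (Measure.count : Measure (Fin 2 → ℤ))) (l := 𝓝[Ioo (-1) 1] t)
          (F := fun r n => w n * ‖coeff L (u r - u t) n‖ₑ ^ 2) (f := fun n => 0)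
          (fun n => 8 * (w n * ENNReal.ofReal (A n)))
          (Eventually.of_forall fun r => measurable_of_countable _) ?_ ?_ ?_
        · simpa only [lintegral_count, tsum_zero] using hdc
        · filter_upwards [self_mem_nhdsWithin] with r hr
          refine ae_of_all _ fun n => ?_
          rw [hu ht, hu hr, coeff_sub, hcoef, hcoef, mul_left_comm]
          refine mul_le_mul_right ?_ _
          rw [← ofReal_norm, ← ENNReal.ofReal_pow (norm_nonneg _)]
          have h8 : ‖phase L r n * G n r - phase L t n * G n t‖ ^ 2 ≤ 8 * A n := by
            have h1 := norm_sub_le (phase L r n * G n r) (phase L t n * G n t)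
            simp only [norm_mul, norm_phase, one_mul] at h1
            have h2 := hGbound n r hr
            have h3 := hGbound n t ht
            have h4 : ‖phase L r n * G n r - phase L t n * G n t‖ ^ 2 ≤
              (‖G n r‖ + ‖G n t‖) ^ 2 := by gcongr
            nlinarith [sq_nonneg (‖G n r‖ - ‖G n t‖)]
          refine (ENNReal.ofReal_le_ofReal h8).trans_eq ?_
          rw [ENNReal.ofReal_mul (by norm_num)]; simp
        · rw [lintegral_count, ENNReal.tsum_mul_left]
          exact (ENNReal.mul_lt_top (by simp) (hwA.trans_lt hE'.lt_top)).ne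
        · refine ae_of_all _ fun n => ?_
          have hc : Continuous fun r => w n * ‖phase L r n * G n r - phase L t n * G n t‖ₑ ^ 2 := by
            refine (ENNReal.continuous_const_mul ENNReal.ofReal_ne_top).comp ?_
            exact (ENNReal.continuous_pow 2).comp (continuous_enorm.comp
              (((continuous_phase L n).mul (hGcont n)).sub continuous_const))
          have h0 := hc.tendsto t
          simp only [sub_self, enorm_zero, ne_eq, OfNat.ofNat_ne_zero, not_false_eq_true, zero_pow,
            mul_zero] at h0
          refine (h0.mono_left nhdsWithin_le_nhds).congr' ?_
          filter_upwards [self_mem_nhdsWithin] with r hr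
          rw [hu ht, hu hr, coeff_sub, hcoef, hcoef]
      have := (ENNReal.continuous_rpow_const (y := (1 / 2 : ℝ))).tendsto 0 |>.comp key
      rw [ENNReal.zero_rpow_of_pos (by norm_num)] at this
      exact this
  rw [xNorm, if_pos hcont]
  refine iSup_le fun J => iSup_le fun _ => iSup_le fun hJ => iSup_le fun _ => ?_
  -- One extension serves every J: the Duhamel integral on the whole line.
  refine iInf₂_le_of_le (duhamel L (-1) H) (fun t ht => (hu (hJ ht)).symm) ?_
  rw [xNormLine]
  refine ENNReal.rpow_le_rpow ?_ (by norm_num)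
  refine le_trans ?_ (mul_le_mul_right hwA _)
  rw [← ENNReal.tsum_mul_left]
  refine ENNReal.tsum_le_tsum fun n => ?_
  rw [mul_left_comm]
  refine mul_le_mul_right ?_ _
  have hfun : (fun t => coeff L (schr L (-t) (duhamel L (-1) H t)) n) = G n := by
    ext t
    rw [coeff_schr, hcoef, ← mul_assoc, ← phase_add, neg_add_cancel, phase_zero, one_mul]
  have hp0 : ∀ t, a < |t| → p n t = 0 := fun t ht => by simp only [hp, hsupp t ht, coeff_zero, mul_zero]
  have hGa : G n (-a) = 0 := by
    simp only [hG]
    rw [intervalIntegral.integral_of_le (by linarith), integral_Ioc_eq_integral_Ioo]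
    refine setIntegral_eq_zero_of_forall_eq_zero fun x hx => hp0 x ?_
    rw [lt_abs]; right; linarith [hx.2]
  have h := u2Norm_primitive_le ha (hpint n) (hpint2 n) hp0 (G := G n) (fun s t => by
    simp only [hG]
    exact intervalIntegral.integral_interval_sub_left (hpint n).intervalIntegrable
      (hpint n).intervalIntegrable) hGa
  rw [hfun]
  refine (pow_le_pow_left' h 2).trans_eq ?_
  rw [← ENNReal.ofReal_pow (by positivity), mul_pow, Real.sq_sqrt (mul_nonneg (by positivity) (hA0 n)),
    ← ENNReal.ofReal_mul (by positivity)]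
  congr 1
  ring

end Duhamel

/-! ### Short time, small scale estimate for high frequency free solutions -/

theorem sum_pow_le_of_injOn {ι : Type*} (S : Finset ι) {g : ι → ℕ} (hg : Set.InjOn g S) {r : ℝ}
    (hr0 : 0 ≤ r) (hr1 : r < 1) : ∑ m ∈ S, r ^ g m ≤ (1 - r)⁻¹ := by
  classical
  rw [← Finset.sum_image (f := fun k => r ^ k) hg, ← tsum_geometric_of_lt_one hr0 hr1]
  exact (summable_geometric_of_lt_one hr0 hr1).sum_le_tsum _ fun k _ => by positivity

theorem inv_one_sub_exp_neg_le {γ : ℝ} (hγ : 0 < γ) : (1 - Real.exp (-γ))⁻¹ ≤ 1 + 1 / γ := by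
  have h1 : Real.exp (-γ) ≤ 1 / (1 + γ) := by
    rw [Real.exp_neg, ← one_div]
    exact one_div_le_one_div_of_le (by positivity) (by linarith [Real.add_one_le_exp γ])
  have h2 : γ / (1 + γ) ≤ 1 - Real.exp (-γ) := by
    have : γ / (1 + γ) = 1 - 1 / (1 + γ) := by field_simp; ring
    linarith
  calc (1 - Real.exp (-γ))⁻¹ ≤ (γ / (1 + γ))⁻¹ := inv_anti₀ (by positivity) h2
    _ = 1 + 1 / γ := by field_simp; ring

/-- The sum of `e^{-β|h|}` over values `h` that are `δ`-separated. -/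
theorem sum_exp_le_of_separated {ι : Type*} (S : Finset ι) {z : ι → ℤ} (hz : Set.InjOn z S)
    {h : ι → ℝ} {β δ : ℝ} (hβ : 0 < β) (hδ : 0 < δ)
    (hsep : ∀ k ∈ S, ∀ l ∈ S, δ * |(z k - z l : ℝ)| ≤ |h k - h l|) :
    ∑ k ∈ S, Real.exp (-(β * |h k|)) ≤ 2 + 4 / (β * δ) := by
  classical
  rcases S.eq_empty_or_nonempty with rfl | hne
  · simp; positivity
  -- Comparing with the smallest value gives |h k - h m| ≤ 2|h k|, so |h k| grows at least like δ|z
  -- k - z m|/2. The sum is then at most two geometric series, one on each side of z m.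
  obtain ⟨m, hm, hmin⟩ := S.exists_min_image (fun k => |h k|) hne
  set γ := β * δ / 2 with hγ
  have hγ0 : 0 < γ := by positivity
  set r := Real.exp (-γ) with hr
  have hr0 : 0 ≤ r := (Real.exp_pos _).le
  have hr1 : r < 1 := by rw [hr, Real.exp_lt_one_iff]; linarith
  have hterm : ∀ k ∈ S, Real.exp (-(β * |h k|)) ≤ r ^ (z k - z m).natAbs := by
    intro k hk
    rw [hr, ← Real.exp_nat_mul, Real.exp_le_exp]
    have h1 : (((z k - z m).natAbs : ℕ) : ℝ) = |(z k - z m : ℝ)| := by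
      rw [Nat.cast_natAbs]; push_cast; rfl
    have h2 := hsep k hk m hm
    have h3 : |h k - h m| ≤ 2 * |h k| := by
      have := hmin k hk
      linarith [abs_sub (h k) (h m)]
    rw [h1, hγ]
    nlinarith
  refine (Finset.sum_le_sum hterm).trans ?_
  rw [← Finset.sum_filter_add_sum_filter_not S (fun k => z m ≤ z k)]
  have h1 : ∑ k ∈ S with z m ≤ z k, r ^ (z k - z m).natAbs ≤ (1 - r)⁻¹ := by
    refine sum_pow_le_of_injOn _ (fun k hk l hl hkl => ?_) hr0 hr1
    simp only [Finset.coe_filter, mem_ofPred_eq] at hk hl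
    exact hz hk.1 hl.1 (by have := hk.2; have := hl.2; omega)
  have h2 : ∑ k ∈ S with ¬ z m ≤ z k, r ^ (z k - z m).natAbs ≤ (1 - r)⁻¹ := by
    refine sum_pow_le_of_injOn _ (fun k hk l hl hkl => ?_) hr0 hr1
    simp only [Finset.coe_filter, mem_ofPred_eq] at hk hl
    exact hz hk.1 hl.1 (by have := hk.2; have := hl.2; omega)
  have h3 := inv_one_sub_exp_neg_le hγ0
  have h4 : 2 * (1 + 1 / γ) = 2 + 4 / (β * δ) := by rw [hγ]; field_simp; ring
  linarith

theorem integral_gaussian_mul_phase {a : ℝ} (ha : 0 < a) (τ : ℝ) :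
    ‖∫ t : ℝ, Complex.exp (Complex.I * τ * t) * Complex.exp (-((a ^ 2)⁻¹ : ℝ) * (t : ℂ) ^ 2)‖ =
      √Real.pi * a * Real.exp (-(a ^ 2 * τ ^ 2 / 4)) := by
  have hb : 0 < (((a ^ 2)⁻¹ : ℝ) : ℂ).re := by rw [Complex.ofReal_re]; positivity
  rw [fourierIntegral_gaussian hb, norm_mul]
  congr 1
  · rw [← Complex.ofReal_div, Complex.norm_cpow_eq_rpow_re_of_pos (by positivity), div_inv_eq_mul]
    have : (1 / 2 : ℂ).re = 1 / 2 := by norm_num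
    rw [this, ← Real.sqrt_eq_rpow, Real.sqrt_mul Real.pi_pos.le, Real.sqrt_sq ha.le]
  · rw [Complex.norm_exp]
    congr 1
    rw [show -(τ : ℂ) ^ 2 / (4 * (((a ^ 2)⁻¹ : ℝ) : ℂ)) = ((-τ ^ 2 / (4 * (a ^ 2)⁻¹) : ℝ) : ℂ) by
      push_cast; rfl, Complex.ofReal_re]
    field_simp

/-- A large sieve inequality on the time interval `[-a, a]`. -/
theorem lintegral_exp_sum_le {ι : Type*} (Q : Finset ι) (b : ι → ℂ) (μ : ι → ℝ) {a S : ℝ}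
    (ha : 0 < a) (hS : ∀ k ∈ Q, b k ≠ 0 →
      ∑ l ∈ Q, Real.exp (-(a ^ 2 * (μ l - μ k) ^ 2 / 4)) ≤ S) :
    ∫⁻ t in Icc (-a) a, ‖∑ k ∈ Q, Complex.exp (-(Complex.I * t * μ k)) * b k‖ₑ ^ 2 ≤
      ENNReal.ofReal (6 * a * S * ∑ k ∈ Q, ‖b k‖ ^ 2) := by
  set F : ℝ → ℂ := fun t => ∑ k ∈ Q, Complex.exp (-(Complex.I * t * μ k)) * b k with hF
  -- The Gaussian is at least e⁻¹ on [-a, a], and its Fourier transform is positive and explicit, so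
  -- the square can be expanded and integrated term by term.
  set W : ℝ → ℂ := fun t => Complex.exp (-((a ^ 2)⁻¹ : ℝ) * (t : ℂ) ^ 2) with hW
  have hWre : ∀ t, W t = (Real.exp (-((a ^ 2)⁻¹ * t ^ 2)) : ℂ) := fun t => by
    simp only [hW]; push_cast; congr 1; ring
  have hb : 0 < (((a ^ 2)⁻¹ : ℝ) : ℂ).re := by rw [Complex.ofReal_re]; positivity
  have hWint : Integrable fun t : ℝ => Real.exp (-((a ^ 2)⁻¹ * t ^ 2)) := by
    have := integrable_exp_neg_mul_sq (b := (a ^ 2)⁻¹) (by positivity)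
    simpa only [neg_mul] using this
  have hsq : ∀ t, ((Real.exp (-((a ^ 2)⁻¹ * t ^ 2)) * ‖F t‖ ^ 2 : ℝ) : ℂ) =
      ∑ k ∈ Q, ∑ l ∈ Q, (b k * conj (b l)) *
        (Complex.exp (Complex.I * ((μ l - μ k : ℝ) : ℂ) * t) * W t) := by
    intro t
    have h1 : ((‖F t‖ ^ 2 : ℝ) : ℂ) = F t * conj (F t) := by
      rw [Complex.mul_conj, Complex.normSq_eq_norm_sq]
    rw [Complex.ofReal_mul, h1, ← hWre, hF]
    simp only [map_sum]
    rw [Finset.sum_mul_sum, Finset.mul_sum]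
    refine Finset.sum_congr rfl fun k _ => ?_
    rw [Finset.mul_sum]
    refine Finset.sum_congr rfl fun l _ => ?_
    have h2 : Complex.exp (Complex.I * ((μ l - μ k : ℝ) : ℂ) * t) =
        Complex.exp (-(Complex.I * t * μ k)) * conj (Complex.exp (-(Complex.I * t * μ l))) := by
      rw [← Complex.exp_conj, ← Complex.exp_add]
      congr 1
      simp only [map_neg, map_mul, Complex.conj_I, Complex.conj_ofReal]
      push_cast; ring
    rw [h2, map_mul]; ring
  have hint : ∀ k l, Integrable fun t : ℝ => (b k * conj (b l)) *
        (Complex.exp (Complex.I * ((μ l - μ k : ℝ) : ℂ) * t) * W t) := by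
    intro k l
    refine Integrable.const_mul ?_ _
    have hWc : Integrable W :=
      (hWint.ofReal (𝕜 := ℂ)).congr (ae_of_all _ fun t => (hWre t).symm)
    refine hWc.bdd_mul (c := 1) (by fun_prop) (ae_of_all _ fun t => ?_)
    rw [show Complex.I * ((μ l - μ k : ℝ) : ℂ) * t = (((μ l - μ k) * t : ℝ) : ℂ) * Complex.I by
      push_cast; ring, Complex.norm_exp_ofReal_mul_I]
  have hFint : Integrable fun t : ℝ => Real.exp (-((a ^ 2)⁻¹ * t ^ 2)) * ‖F t‖ ^ 2 := by
    have h1 := integrable_finsetSum Q fun k _ => integrable_finsetSum Q fun l _ => hint k l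
    simp only [← hsq] at h1
    exact h1.re
  have hK : ∀ k l, ‖∫ t : ℝ, (b k * conj (b l)) *
      (Complex.exp (Complex.I * ((μ l - μ k : ℝ) : ℂ) * t) * W t)‖ =
      √Real.pi * a * (‖b k‖ * ‖b l‖ * Real.exp (-(a ^ 2 * (μ l - μ k) ^ 2 / 4))) := by
    intro k l
    rw [integral_const_mul, norm_mul, norm_mul, RCLike.norm_conj, integral_gaussian_mul_phase ha]
    ring
  have hmain : ∫ t : ℝ, Real.exp (-((a ^ 2)⁻¹ * t ^ 2)) * ‖F t‖ ^ 2 ≤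
      √Real.pi * a * (S * ∑ k ∈ Q, ‖b k‖ ^ 2) := by
    have h1 : ((∫ t : ℝ, Real.exp (-((a ^ 2)⁻¹ * t ^ 2)) * ‖F t‖ ^ 2 : ℝ) : ℂ) =
        ∑ k ∈ Q, ∑ l ∈ Q, ∫ t : ℝ, (b k * conj (b l)) *
          (Complex.exp (Complex.I * ((μ l - μ k : ℝ) : ℂ) * t) * W t) := by
      rw [← integral_complex_ofReal]
      simp only [hsq]
      rw [integral_finsetSum _ fun k _ => integrable_finsetSum Q fun l _ => hint k l]
      exact Finset.sum_congr rfl fun k _ => integral_finsetSum _ fun l _ => hint k l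
    have h2 : ∫ t : ℝ, Real.exp (-((a ^ 2)⁻¹ * t ^ 2)) * ‖F t‖ ^ 2 ≤
        ∑ k ∈ Q, ∑ l ∈ Q, √Real.pi * a *
          (‖b k‖ * ‖b l‖ * Real.exp (-(a ^ 2 * (μ l - μ k) ^ 2 / 4))) := by
      refine (le_abs_self _).trans ?_
      rw [← Real.norm_eq_abs, ← Complex.norm_real, h1]
      refine (norm_sum_le _ _).trans (Finset.sum_le_sum fun k _ => ?_)
      refine (norm_sum_le _ _).trans (Finset.sum_le_sum fun l _ => ?_)
      exact (hK k l).le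
    refine h2.trans ?_
    simp only [← Finset.mul_sum]
    refine mul_le_mul_of_nonneg_left ?_ (by positivity)
    -- Schur's test for a symmetric kernel: 2‖b k‖‖b l‖ is split into squares, and by symmetry both
    -- halves are controlled by the row sums. A row with b k = 0 contributes nothing, so its sum
    -- need not be bounded.
    set κ : ι → ι → ℝ := fun k l => Real.exp (-(a ^ 2 * (μ l - μ k) ^ 2 / 4)) with hκ
    have hsymm : ∀ k l, κ k l = κ l k := fun k l => by
      simp only [hκ]; congr 3; ring
    have hκ0 : ∀ k l, 0 ≤ κ k l := fun k l => (Real.exp_pos _).le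
    have h3 : ∑ k ∈ Q, ∑ l ∈ Q, ‖b k‖ ^ 2 * κ k l ≤ S * ∑ k ∈ Q, ‖b k‖ ^ 2 := by
      rw [Finset.mul_sum]
      refine Finset.sum_le_sum fun k hk => ?_
      rw [← Finset.mul_sum, mul_comm S]
      by_cases hbk : b k = 0
      · simp [hbk]
      · exact mul_le_mul_of_nonneg_left (hS k hk hbk) (by positivity)
    have h4 : ∑ k ∈ Q, ∑ l ∈ Q, ‖b l‖ ^ 2 * κ k l = ∑ k ∈ Q, ∑ l ∈ Q, ‖b k‖ ^ 2 * κ k l := by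
      rw [Finset.sum_comm]
      exact Finset.sum_congr rfl fun k _ => Finset.sum_congr rfl fun l _ => by rw [hsymm]
    have h5 : ∑ k ∈ Q, ∑ l ∈ Q, ‖b k‖ * ‖b l‖ * κ k l ≤
        ∑ k ∈ Q, ∑ l ∈ Q, (‖b k‖ ^ 2 * κ k l + ‖b l‖ ^ 2 * κ k l) / 2 := by
      refine Finset.sum_le_sum fun k _ => Finset.sum_le_sum fun l _ => ?_
      nlinarith [mul_nonneg (hκ0 k l) (sq_nonneg (‖b k‖ - ‖b l‖))]
    refine h5.trans ?_
    simp only [← Finset.sum_div, Finset.sum_add_distrib]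
    rw [h4]
    linarith
  have hpt : ∀ t ∈ Icc (-a) a, ‖F t‖ₑ ^ 2 ≤
      ENNReal.ofReal (Real.exp 1 * (Real.exp (-((a ^ 2)⁻¹ * t ^ 2)) * ‖F t‖ ^ 2)) := by
    intro t ht
    rw [← ofReal_norm, ← ENNReal.ofReal_pow (norm_nonneg _)]
    refine ENNReal.ofReal_le_ofReal ?_
    rw [← mul_assoc, ← Real.exp_add]
    refine le_mul_of_one_le_left (by positivity) (Real.one_le_exp ?_)
    have : t ^ 2 ≤ a ^ 2 := sq_le_sq' ht.1 ht.2
    have h2 : (a ^ 2)⁻¹ * t ^ 2 ≤ 1 := by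
      rw [inv_mul_le_iff₀ (by positivity)]; linarith
    linarith
  calc ∫⁻ t in Icc (-a) a, ‖F t‖ₑ ^ 2
      ≤ ∫⁻ t in Icc (-a) a,
        ENNReal.ofReal (Real.exp 1 * (Real.exp (-((a ^ 2)⁻¹ * t ^ 2)) * ‖F t‖ ^ 2)) :=
        setLIntegral_mono' measurableSet_Icc hpt
    _ ≤ ∫⁻ t, ENNReal.ofReal (Real.exp 1 * (Real.exp (-((a ^ 2)⁻¹ * t ^ 2)) * ‖F t‖ ^ 2)) :=
        setLIntegral_le_lintegral _ _
    _ = ENNReal.ofReal (∫ t, Real.exp 1 * (Real.exp (-((a ^ 2)⁻¹ * t ^ 2)) * ‖F t‖ ^ 2)) :=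
        (ofReal_integral_eq_lintegral_ofReal (hFint.const_mul _)
          (ae_of_all _ fun t => by positivity)).symm
    _ ≤ _ := by
        refine ENNReal.ofReal_le_ofReal ?_
        rw [integral_const_mul]
        have h0 : 0 ≤ ∫ t, Real.exp (-((a ^ 2)⁻¹ * t ^ 2)) * ‖F t‖ ^ 2 :=
          integral_nonneg fun t => by positivity
        -- No sign is assumed for `S`; that of the product is read off `hmain`.
        have hSb : 0 ≤ S * ∑ k ∈ Q, ‖b k‖ ^ 2 := by
          have := h0.trans hmain
          have hpos : 0 < √Real.pi * a := mul_pos (Real.sqrt_pos.2 Real.pi_pos) ha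
          exact nonneg_of_mul_nonneg_right this hpos
        have he : Real.exp 1 ≤ 3 := by linarith [Real.exp_one_lt_d9]
        have hpi : √Real.pi ≤ 2 := by
          rw [Real.sqrt_le_left (by norm_num)]; linarith [Real.pi_lt_four]
        calc _ ≤ 3 * (2 * a * (S * ∑ k ∈ Q, ‖b k‖ ^ 2)) := by
              refine mul_le_mul he (hmain.trans ?_) h0 (by norm_num)
              gcongr
          _ = _ := by ring

/-! ### Counting frequencies of nearly equal length in a box -/

section Box

variable (L : Fin 2 → ℝ)

/-- The number of frequencies in the `i`-th direction of a box of side comparable to `N`. -/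
noncomputable def boxSide (N : ℝ) (i : Fin 2) : ℕ := ⌈L i * N / (2 * Real.pi)⌉₊

/-- A box of frequency indices with side comparable to `N`. -/
noncomputable def box (N : ℝ) : Finset (Fin 2 → ℤ) :=
  Fintype.piFinset fun i => Finset.Ico (0 : ℤ) (boxSide L N i)

theorem mem_box {N : ℝ} {k : Fin 2 → ℤ} : k ∈ box L N ↔ ∀ i, 0 ≤ k i ∧ k i < boxSide L N i := by
  simp [box, Fintype.mem_piFinset]

theorem card_box (N : ℝ) : (box L N).card = boxSide L N 0 * boxSide L N 1 := by
  simp [box, Fin.prod_univ_two]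

theorem le_boxSide (N : ℝ) (i : Fin 2) : L i * N / (2 * Real.pi) ≤ boxSide L N i := Nat.le_ceil _

theorem boxSide_lt {N : ℝ} (hN : 0 ≤ N) {i : Fin 2} (hL : 0 < L i) :
    (boxSide L N i : ℝ) < L i * N / (2 * Real.pi) + 1 :=
  Nat.ceil_lt_add_one (by positivity)

theorem boxSide_le {N : ℝ} (hN : 1 ≤ N) {i : Fin 2} (hL : 0 < L i) :
    (boxSide L N i : ℝ) ≤ (1 + L i) * N := by
  have h1 := boxSide_lt L (by linarith : 0 ≤ N) hL
  have h2 : L i * N / (2 * Real.pi) ≤ L i * N :=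
    div_le_self (by positivity) (by linarith [Real.pi_gt_three])
  linarith

theorem boxSide_pos {N : ℝ} (hN : 0 < N) {i : Fin 2} (hL : 0 < L i) : 0 < boxSide L N i :=
  Nat.ceil_pos.2 (by have := Real.pi_pos; positivity)

theorem freq_apply (n : Fin 2 → ℤ) (i : Fin 2) : freq L n i = 2 * Real.pi / L i * n i := by
  simp only [freq]; ring

theorem norm_freq_sq (n : Fin 2 → ℤ) : ‖freq L n‖ ^ 2 = ∑ i, freq L n i ^ 2 := by
  rw [EuclideanSpace.norm_sq_eq]; simp

/-- Rounding the side up costs nothing: indices in the box differ by at most the side minus one,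
which is below L i · N / 2π. -/
theorem mul_abs_sub_le_of_mem_box {N : ℝ} (hN : 0 < N) (hL : ∀ i, 0 < L i) {k l : Fin 2 → ℤ}
    (hk : k ∈ box L N) (hl : l ∈ box L N) (i : Fin 2) :
    2 * Real.pi / L i * |(k i - l i : ℝ)| ≤ N := by
  have h1 := (mem_box L).1 hk i
  have h2 := (mem_box L).1 hl i
  have h3 : |(k i - l i : ℝ)| ≤ boxSide L N i - 1 := by
    have : |k i - l i| ≤ boxSide L N i - 1 := by rw [abs_le]; constructor <;> omega
    exact_mod_cast this
  have h4 := boxSide_lt L hN.le (hL i)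
  have hpi := Real.pi_pos
  have hLi := hL i
  calc 2 * Real.pi / L i * |(k i - l i : ℝ)|
      ≤ 2 * Real.pi / L i * (L i * N / (2 * Real.pi)) := by gcongr; linarith
    _ = N := by field_simp

/-- In a box of side `N` around a frequency `p` with `|p| ≥ B N`, few frequencies have nearly the
same length as `p`. -/
theorem sum_box_exp_le (hL : ∀ i, 0 < L i) {N B : ℝ} (hN : 1 ≤ N) (hB : 2 ≤ B)
    (n : Fin 2 → ℤ) {k₀ : Fin 2 → ℤ} (hk₀ : k₀ ∈ box L N) (hp : B * N ≤ ‖freq L (n - k₀)‖) :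
    ∑ k ∈ box L N, Real.exp (-(((N ^ 2)⁻¹) ^ 2 *
      (‖freq L (n - k)‖ ^ 2 - ‖freq L (n - k₀)‖ ^ 2) ^ 2 / 4)) ≤
      400 * ((1 + L 0) * (1 + L 1)) * (N * (1 + N / B)) := by
  classical
  have hpi := Real.pi_gt_three
  have hN0 : 0 < N := by linarith
  have hB0 : 0 < B := by linarith
  -- Direction i is the one in which p is larger, hence at least BN/√2; j is the other.
  obtain ⟨i, j, hij, hcov, hi⟩ : ∃ i j : Fin 2, i ≠ j ∧ (∀ m : Fin 2, m = i ∨ m = j) ∧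
      (B * N) ^ 2 / 2 ≤ freq L (n - k₀) i ^ 2 := by
    have h1 : (B * N) ^ 2 ≤ ‖freq L (n - k₀)‖ ^ 2 := by gcongr
    rw [norm_freq_sq, Fin.sum_univ_two] at h1
    rcases le_total (freq L (n - k₀) 0 ^ 2) (freq L (n - k₀) 1 ^ 2) with h | h
    · exact ⟨1, 0, by decide, by decide, by linarith⟩
    · exact ⟨0, 1, by decide, by decide, by linarith⟩
  have hcover : ∀ f : Fin 2 → ℝ, ∑ m, f m = f i + f j := by
    intro f
    rw [Fin.sum_univ_two]
    rcases hcov 0 with h0 | h0 <;> rcases hcov 1 with h1 | h1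
    · exact absurd (h0.trans h1.symm) (by decide)
    · rw [h0, h1]
    · rw [h0, h1]; ring
    · exact absurd (h0.trans h1.symm) (by decide)
  set c := 2 * Real.pi / L i with hc
  have hc0 : 0 < c := by have := hL i; positivity
  set x := freq L (n - k₀) i with hx
  set β := (N ^ 2)⁻¹ / 2 with hβ
  set δ := c * (2 / 5 * (B * N)) with hδ
  have hβ0 : 0 < β := by positivity
  have hδ0 : 0 < δ := by positivity
  set h : (Fin 2 → ℤ) → ℝ := fun k => ‖freq L (n - k)‖ ^ 2 - ‖freq L (n - k₀)‖ ^ 2 with hh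
  -- 7/10 is a rational number below 1/√2.
  have hxlow : 7 / 10 * (B * N) ≤ |x| := by
    refine abs_le_of_sq_le_sq' ?_ (abs_nonneg x) |>.2
    rw [sq_abs]
    nlinarith [sq_nonneg (B * N)]
  have hdiff : ∀ k ∈ box L N, |freq L (n - k) i - x| ≤ N := by
    intro k hk
    have := mul_abs_sub_le_of_mem_box L hN0 hL hk₀ hk i
    have e : (((n - k) i : ℤ) : ℝ) - (((n - k₀) i : ℤ) : ℝ) = (k₀ i : ℝ) - k i := by
      simp only [Pi.sub_apply]; push_cast; ring
    rw [hx, freq_apply, freq_apply, ← mul_sub, abs_mul, abs_of_pos hc0, e]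
    exact this
  have hsep : ∀ k ∈ box L N, ∀ l ∈ box L N, k j = l j →
      δ * |(k i - l i : ℝ)| ≤ |h k - h l| := by
    intro k hk l hl hkl
    have h1 : h k - h l = (freq L (n - k) i - freq L (n - l) i) *
        (freq L (n - k) i + freq L (n - l) i) := by
      simp only [hh, norm_freq_sq, hcover]
      have : freq L (n - k) j = freq L (n - l) j := by
        rw [freq_apply, freq_apply]; simp only [Pi.sub_apply, hkl]
      rw [this]; ring
    have h2 : |freq L (n - k) i - freq L (n - l) i| = c * |(k i - l i : ℝ)| := by
      rw [freq_apply, freq_apply, ← mul_sub, abs_mul, abs_of_pos hc0, abs_sub_comm (k i : ℝ)]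
      congr 2
      simp only [Pi.sub_apply]; push_cast; ring
    -- The sum is within 2N of 2x, and 2N ≤ BN because B ≥ 2; this leaves 7/5 - 1 = 2/5.
    have h3 : 2 / 5 * (B * N) ≤ |freq L (n - k) i + freq L (n - l) i| := by
      have e1 := hdiff k hk
      have e2 := hdiff l hl
      have e3 : |2 * x| ≤ |freq L (n - k) i + freq L (n - l) i| + N + N := by
        have : 2 * x = (freq L (n - k) i + freq L (n - l) i) - (freq L (n - k) i - x)
          - (freq L (n - l) i - x) := by ring
        rw [this]
        exact (abs_sub _ _).trans (add_le_add ((abs_sub _ _).trans (add_le_add le_rfl e1)) e2)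
      rw [abs_mul, abs_of_pos (by norm_num : (0 : ℝ) < 2)] at e3
      nlinarith
    rw [h1, abs_mul, h2, hδ]
    calc c * (2 / 5 * (B * N)) * |(k i - l i : ℝ)| = c * |(k i - l i : ℝ)| * (2 / 5 * (B * N)) := by
          ring
      _ ≤ _ := by gcongr
  -- The Gaussian is replaced by an exponential through s ≤ s² + 1 with s = β|h k|; the loss is e <
  -- 3.
  have hterm : ∀ k, Real.exp (-(((N ^ 2)⁻¹) ^ 2 * (h k) ^ 2 / 4)) ≤
      3 * Real.exp (-(β * |h k|)) := by
    intro k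
    have e1 : -(((N ^ 2)⁻¹) ^ 2 * (h k) ^ 2 / 4) ≤ 1 + -(β * |h k|) := by
      have : ((N ^ 2)⁻¹) ^ 2 * (h k) ^ 2 / 4 = (β * |h k|) ^ 2 := by
        rw [mul_pow, sq_abs, hβ]; ring
      rw [this]
      nlinarith [sq_nonneg (β * |h k| - 1 / 2)]
    refine (Real.exp_le_exp.2 e1).trans ?_
    rw [Real.exp_add]
    gcongr
    linarith [Real.exp_one_lt_d9]
  refine (Finset.sum_le_sum fun k _ => hterm k).trans ?_
  -- The box is sliced into lines parallel to direction i, on each of which the separation `hsep`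
  -- holds.
  rw [← Finset.mul_sum, ← Finset.sum_fiberwise_of_maps_to (s := box L N)
    (t := Finset.Ico (0 : ℤ) (boxSide L N j)) (g := fun k => k j)
    (fun k hk => Finset.mem_Ico.2 ((mem_box L).1 hk j))]
  have hfib : ∀ m : ℤ, ∑ k ∈ box L N with k j = m, Real.exp (-(β * |h k|)) ≤
      2 + 4 / (β * δ) := by
    intro m
    refine sum_exp_le_of_separated _ (z := fun k => k i) ?_ hβ0 hδ0 ?_
    · intro k hk l hl hkl
      simp only [Finset.coe_filter, mem_ofPred_eq] at hk hl
      ext m'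
      rcases hcov m' with rfl | rfl
      · exact hkl
      · rw [hk.2, hl.2]
    · intro k hk l hl
      rw [Finset.mem_filter] at hk hl
      exact hsep k hk.1 l hl.1 (hk.2.trans hl.2.symm)
  have hsum := Finset.sum_le_sum fun m (_ : m ∈ Finset.Ico (0 : ℤ) (boxSide L N j)) => hfib m
  rw [Finset.sum_const, Int.card_Ico, nsmul_eq_mul] at hsum
  have hδβ : 2 + 4 / (β * δ) ≤ 20 * (1 + L i) * (1 + N / B) := by
    have e1 : 4 / (β * δ) = 10 * L i / Real.pi * (N / B) := by
      rw [hβ, hδ, hc]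
      have := (hL i).ne'
      field_simp; norm_num
    have e2 : 10 * L i / Real.pi ≤ 10 * L i :=
      div_le_self (by have := hL i; positivity) (by linarith)
    have e3 : 0 ≤ N / B := by positivity
    have e4 := hL i
    rw [e1]
    nlinarith [mul_le_mul_of_nonneg_right e2 e3, mul_nonneg e4.le e3]
  have hMj := boxSide_le L hN (hL j)
  have hnn : 0 ≤ 2 + 4 / (β * δ) := by positivity
  have hprod : (1 + L 0) * (1 + L 1) = (1 + L i) * (1 + L j) := by
    rcases hcov 0 with h0 | h0 <;> rcases hcov 1 with h1 | h1
    · exact absurd (h0.trans h1.symm) (by decide)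
    · rw [h0, h1]
    · rw [h0, h1]; ring
    · exact absurd (h0.trans h1.symm) (by decide)
  have hLi := hL i
  have hLj := hL j
  have hNB : 0 ≤ N / B := by positivity
  calc 3 * ∑ m ∈ Finset.Ico (0 : ℤ) (boxSide L N j),
        ∑ k ∈ box L N with k j = m, Real.exp (-(β * |h k|))
      ≤ 3 * ((boxSide L N j : ℝ) * (2 + 4 / (β * δ))) := by
        refine mul_le_mul_of_nonneg_left (hsum.trans_eq ?_) (by norm_num)
        simp
    _ ≤ 3 * (((1 + L j) * N) * (20 * (1 + L i) * (1 + N / B))) := by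
        gcongr
    _ ≤ _ := by
        rw [hprod]
        have : 0 ≤ (1 + L i) * (1 + L j) * (N * (1 + N / B)) := by positivity
        nlinarith

/-- The normalised exponential sum over the box, a function which is large near the origin. -/
noncomputable def boxKernel (N : ℝ) (x : Torus L) : ℂ :=
  ((box L N).card : ℂ)⁻¹ * ∑ k ∈ box L N, character L k x

theorem continuous_boxKernel (N : ℝ) : Continuous (boxKernel L N) := by
  unfold boxKernel; fun_prop

theorem exists_coe_abs_eq {T : ℝ} (z : AddCircle T) :
    ∃ r : ℝ, (r : AddCircle T) = z ∧ |r| = ‖z‖ := by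
  obtain ⟨r, rfl⟩ := QuotientAddGroup.mk_surjective z
  refine ⟨r - round (T⁻¹ * r) * T, ?_, ?_⟩
  · rw [AddCircle.coe_sub, sub_eq_self]
    exact (AddCircle.coe_eq_zero_iff T).2 ⟨round (T⁻¹ * r), by simp⟩
  · exact (AddCircle.norm_eq T).symm

end Box

/-! ### High-frequency free solutions on a small space-time region -/

section LocalSmoothing

variable (L : Fin 2 → ℝ) [∀ i, Fact (0 < L i)]

/-- For |x| ≤ N⁻¹ all phases of the one-dimensional sums are at most 1, so each term has real part
at least 1/2. The normalised product is thus at least 1/4, whence the 16. -/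
theorem one_le_boxKernel {N : ℝ} (hN : 1 ≤ N) {x : Torus L} (hx : torusAbs x ≤ N⁻¹) :
    1 ≤ 16 * ‖boxKernel L N x‖ ^ 2 := by
  have hN0 : 0 < N := by linarith
  have hL : ∀ i, 0 < L i := fun i => Fact.out
  have hcoord : ∀ i, ‖x i‖ ≤ N⁻¹ := by
    intro i
    refine le_trans ?_ hx
    apply Real.le_sqrt_of_sq_le
    exact Finset.single_le_sum (f := fun i => ‖x i‖ ^ 2) (fun j _ => by positivity)
      (Finset.mem_univ i)
  have hone : ∀ i, (boxSide L N i : ℝ) / 2 ≤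
      ‖∑ k ∈ Finset.Ico (0 : ℤ) (boxSide L N i), fourier k (x i)‖ := by
    intro i
    obtain ⟨r, hr, hr'⟩ := exists_coe_abs_eq (x i)
    refine le_trans ?_ (Complex.re_le_norm _)
    rw [Complex.re_sum]
    have hterm : ∀ k ∈ Finset.Ico (0 : ℤ) (boxSide L N i),
        (1 / 2 : ℝ) ≤ (fourier k (x i)).re := by
      intro k hk
      rw [Finset.mem_Ico] at hk
      rw [← hr, fourier_coe_apply, show 2 * (Real.pi : ℂ) * Complex.I * k * r / L i =
        ((2 * Real.pi / L i * k * r : ℝ) : ℂ) * Complex.I by push_cast; ring,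
        Complex.exp_ofReal_mul_I_re]
      have h1 : |2 * Real.pi / L i * k * r| ≤ 1 := by
        have hk0 : (0 : ℝ) ≤ k := by exact_mod_cast hk.1
        have h3 : (k : ℝ) ≤ boxSide L N i - 1 := by
          have : k ≤ boxSide L N i - 1 := by omega
          exact_mod_cast this
        have h4 := boxSide_lt L hN0.le (hL i)
        have hpi := Real.pi_pos
        have hLi := hL i
        rw [abs_mul, abs_of_nonneg (by positivity : 0 ≤ 2 * Real.pi / L i * k), hr']
        calc 2 * Real.pi / L i * k * ‖x i‖ ≤
              2 * Real.pi / L i * (L i * N / (2 * Real.pi)) * N⁻¹ := by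
              gcongr
              · linarith
              · exact hcoord i
          _ = 1 := by field_simp
      have h2 := Real.one_sub_sq_div_two_le_cos (x := 2 * Real.pi / L i * k * r)
      have h3 := sq_le_one_iff_abs_le_one _ |>.2 h1
      linarith
    have := Finset.sum_le_sum hterm
    rw [Finset.sum_const, Int.card_Ico, nsmul_eq_mul] at this
    refine le_trans (le_of_eq ?_) this
    simp; ring
  have hprod : ∑ k ∈ box L N, character L k x =
      ∏ i, ∑ k ∈ Finset.Ico (0 : ℤ) (boxSide L N i), fourier k (x i) := by
    rw [Finset.prod_univ_sum]; rfl
  have h0 : (0 : ℝ) < boxSide L N 0 := by exact_mod_cast boxSide_pos L hN0 (hL 0)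
  have h1 : (0 : ℝ) < boxSide L N 1 := by exact_mod_cast boxSide_pos L hN0 (hL 1)
  have hlow : 1 / 4 ≤ ‖boxKernel L N x‖ := by
    rw [boxKernel, norm_mul, hprod, norm_prod, Fin.prod_univ_two, norm_inv, card_box]
    have := mul_le_mul (hone 0) (hone 1) (by positivity) (norm_nonneg _)
    rw [Complex.norm_natCast, inv_mul_eq_div, le_div_iff₀ (by push_cast; positivity)]
    push_cast
    linarith
  nlinarith

variable {L}

theorem memLp_continuous_mul {W F : Torus L → ℂ} (hW : Continuous W) (hF : MemLp F 2 (haar L)) :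
    MemLp (fun x => W x * F x) 2 (haar L) := by
  obtain ⟨C, hC⟩ := isCompact_univ.exists_bound_of_continuousOn hW.continuousOn
  exact MemLp.of_le_mul (c := C) hF (hW.aestronglyMeasurable.mul hF.1) (ae_of_all _ fun x => by
    rw [norm_mul]; exact mul_le_mul_of_nonneg_right (hC x trivial) (norm_nonneg _))

theorem fcoef_const_mul (c : ℂ) (F : Torus L → ℂ) (n : Fin 2 → ℤ) :
    fcoef L (fun x => c * F x) n = c * fcoef L F n := by
  simp only [fcoef, ← integral_const_mul]
  congr 1; ext x; ring

/-- On the Fourier side the kernel averages over a translated box, so the coefficients of a free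
solution become exponential sums in time over that box. -/
theorem fcoef_boxKernel_mul {N : ℝ} {F : Torus L → ℂ} (hF : MemLp F 2 (haar L)) (n : Fin 2 → ℤ) :
    fcoef L (fun x => boxKernel L N x * F x) n =
      ((box L N).card : ℂ)⁻¹ * ∑ k ∈ box L N, fcoef L F (n - k) := by
  have h : (fun x => boxKernel L N x * F x) = fun x => ((box L N).card : ℂ)⁻¹ *
      ∑ k ∈ box L N, character L k x * F x := by
    ext x; rw [boxKernel, mul_assoc, Finset.sum_mul]
  rw [h, fcoef_const_mul]
  congr 1
  rw [Finset.sum_congr rfl fun k _ => (fcoef_character_mul k F n).symm]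
  simp only [fcoef, Finset.mul_sum]
  exact integral_finsetSum _ fun k _ => integrable_conj_character_mul
    (memLp_continuous_mul (character L k).continuous hF) n

variable (L) in
/-- The constant in the local smoothing estimate. -/
noncomputable def smoothingConst : ℝ :=
  16 * 6 * (400 * ((1 + L 0) * (1 + L 1))) * (2 * Real.pi) ^ 2 / (L 0 * L 1)

theorem smoothingConst_nonneg : 0 ≤ smoothingConst L := by
  have h0 : 0 < L 0 := Fact.out
  have h1 : 0 < L 1 := Fact.out
  unfold smoothingConst; positivity

/-- A free solution with frequencies beyond `B N` is small on the space-time region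
`|t| ≤ N⁻²`, `|x| ≤ N⁻¹`. -/
theorem lintegral_free_solution_le {N B : ℝ} (hN : 1 ≤ N) (hB : 2 ≤ B) {b : (Fin 2 → ℤ) → ℂ}
    (hb : ∀ n, b n ≠ 0 → B * N ≤ ‖freq L n‖) {V : ℝ → Torus L → ℂ}
    (hV : ∀ t, MemLp (V t) 2 (haar L)) (hVb : ∀ t n, fcoef L (V t) n = phase L t n * b n) :
    ∫⁻ t in Icc (-(N ^ 2)⁻¹) (N ^ 2)⁻¹,
      ∫⁻ x in {x : Torus L | torusAbs x ≤ N⁻¹}, ‖V t x‖ₑ ^ 2 ∂(haar L) ≤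
      ENNReal.ofReal (smoothingConst L * ((N ^ 2)⁻¹ * (B⁻¹ + N⁻¹))) * ∑' n, ‖b n‖ₑ ^ 2 := by
  have hN0 : 0 < N := by linarith
  have hB0 : 0 < B := by linarith
  have hL : ∀ i, 0 < L i := fun i => Fact.out
  have h0 : (0 : ℝ) < boxSide L N 0 := by exact_mod_cast boxSide_pos L hN0 (hL 0)
  have h1 : (0 : ℝ) < boxSide L N 1 := by exact_mod_cast boxSide_pos L hN0 (hL 1)
  set a := (N ^ 2)⁻¹ with ha
  have ha0 : 0 < a := by positivity
  set m : ℝ := ((box L N).card : ℝ) with hm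
  have hm0 : 0 < m := by rw [hm, card_box]; push_cast; positivity
  set S := 400 * ((1 + L 0) * (1 + L 1)) * (N * (1 + N / B)) with hS
  have hS0 : 0 ≤ S := by have := hL 0; have := hL 1; positivity
  set g : ℝ → (Fin 2 → ℤ) → ℂ := fun t n =>
    ∑ k ∈ box L N, Complex.exp (-(Complex.I * t * (‖freq L (n - k)‖ ^ 2 : ℝ))) * b (n - k) with hg
  have hslice : ∀ t, ∫⁻ x in {x : Torus L | torusAbs x ≤ N⁻¹}, ‖V t x‖ₑ ^ 2 ∂(haar L) ≤
      ENNReal.ofReal (16 * (m⁻¹) ^ 2) * ∑' n, ‖g t n‖ₑ ^ 2 := by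
    intro t
    have hmem := memLp_continuous_mul (continuous_boxKernel L N) (hV t)
    calc ∫⁻ x in {x : Torus L | torusAbs x ≤ N⁻¹}, ‖V t x‖ₑ ^ 2 ∂(haar L)
        ≤ ∫⁻ x in {x : Torus L | torusAbs x ≤ N⁻¹}, 16 * ‖boxKernel L N x * V t x‖ₑ ^ 2
            ∂(haar L) := by
          refine setLIntegral_mono' ?_ fun x hx => ?_
          · refine measurableSet_le ?_ measurable_const
            unfold torusAbs; fun_prop
          · have := one_le_boxKernel L hN hx
            rw [enorm_mul, mul_pow, ← mul_assoc]
            refine le_mul_of_one_le_left (by simp) ?_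
            rw [← ofReal_norm, ← ENNReal.ofReal_pow (norm_nonneg _)]
            have h16 : (16 : ℝ≥0∞) = ENNReal.ofReal 16 := by simp
            rw [h16, ← ENNReal.ofReal_mul (by norm_num)]
            exact ENNReal.one_le_ofReal.2 this
      _ ≤ ∫⁻ x, 16 * ‖boxKernel L N x * V t x‖ₑ ^ 2 ∂(haar L) := setLIntegral_le_lintegral _ _
      _ = 16 * ∫⁻ x, ‖boxKernel L N x * V t x‖ₑ ^ 2 ∂(haar L) :=
          lintegral_const_mul' _ _ (by simp)
      _ = _ := by
          rw [lintegral_enorm_sq_eq_tsum hmem, ENNReal.ofReal_mul (by norm_num), mul_assoc,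
            ← ENNReal.tsum_mul_left (a := ENNReal.ofReal _)]
          congr 1
          · simp
          · refine tsum_congr fun n => ?_
            rw [fcoef_boxKernel_mul (hV t), enorm_mul, mul_pow]
            congr 1
            · rw [ENNReal.ofReal_pow (by positivity), ← ofReal_norm, norm_inv,
                Complex.norm_natCast]
            · simp only [hVb]; rfl
  have hgmeas : ∀ n, Measurable fun t => ‖g t n‖ₑ ^ 2 := by
    intro n
    refine Continuous.measurable ?_
    refine (ENNReal.continuous_pow 2).comp (continuous_enorm.comp ?_)
    simp only [hg]; fun_prop
  have hgint : ∀ n, ∫⁻ t in Icc (-a) a, ‖g t n‖ₑ ^ 2 ≤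
      ENNReal.ofReal (6 * a * S) * ∑ k ∈ box L N, ‖b (n - k)‖ₑ ^ 2 := by
    intro n
    refine (lintegral_exp_sum_le (box L N) (fun k => b (n - k)) (fun k => ‖freq L (n - k)‖ ^ 2)
      (S := S) ha0 fun k hk hbk => ?_).trans_eq ?_
    · exact sum_box_exp_le L hL hN hB n hk (hb _ hbk)
    · rw [ENNReal.ofReal_mul (by positivity), ENNReal.ofReal_sum_of_nonneg
        (fun k _ => by positivity)]
      congr 1
      refine Finset.sum_congr rfl fun k _ => ?_
      rw [ENNReal.ofReal_pow (norm_nonneg _), ofReal_norm]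
  -- Each frequency lies in m translated boxes. Against the normalisation m⁻² one factor m⁻¹
  -- survives, and m is at least a multiple of N².
  have hshift : ∑' n, ∑ k ∈ box L N, ‖b (n - k)‖ₑ ^ 2 = ENNReal.ofReal m * ∑' n, ‖b n‖ₑ ^ 2 := by
    rw [Summable.tsum_finsetSum fun k _ => ENNReal.summable]
    have : ∀ k, ∑' n, ‖b (n - k)‖ₑ ^ 2 = ∑' n, ‖b n‖ₑ ^ 2 := fun k =>
      (Equiv.subRight k).tsum_eq fun n => ‖b n‖ₑ ^ 2
    simp only [this, Finset.sum_const, nsmul_eq_mul, hm, ENNReal.ofReal_natCast]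
  calc ∫⁻ t in Icc (-a) a, ∫⁻ x in {x : Torus L | torusAbs x ≤ N⁻¹}, ‖V t x‖ₑ ^ 2 ∂(haar L)
      ≤ ∫⁻ t in Icc (-a) a, ENNReal.ofReal (16 * (m⁻¹) ^ 2) * ∑' n, ‖g t n‖ₑ ^ 2 :=
        lintegral_mono fun t => hslice t
    _ = ENNReal.ofReal (16 * (m⁻¹) ^ 2) * ∑' n, ∫⁻ t in Icc (-a) a, ‖g t n‖ₑ ^ 2 := by
        rw [lintegral_const_mul' _ _ ENNReal.ofReal_ne_top,
          lintegral_tsum fun n => (hgmeas n).aemeasurable]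
    _ ≤ ENNReal.ofReal (16 * (m⁻¹) ^ 2) *
          ∑' n, ENNReal.ofReal (6 * a * S) * ∑ k ∈ box L N, ‖b (n - k)‖ₑ ^ 2 :=
        mul_le_mul_right (ENNReal.tsum_le_tsum hgint) _
    _ = ENNReal.ofReal (16 * (m⁻¹) ^ 2 * (6 * a * S) * m) * ∑' n, ‖b n‖ₑ ^ 2 := by
        rw [ENNReal.tsum_mul_left, hshift, ENNReal.ofReal_mul (q := m) (by positivity),
          ENNReal.ofReal_mul (q := 6 * a * S) (by positivity)]
        ring
    _ ≤ _ := by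
        refine mul_le_mul_left (ENNReal.ofReal_le_ofReal ?_) _
        have hmlow : L 0 * L 1 * N ^ 2 / (2 * Real.pi) ^ 2 ≤ m := by
          rw [hm, card_box]
          push_cast
          have e0 := le_boxSide L N 0
          have e1 := le_boxSide L N 1
          have hp := Real.pi_pos
          have hL0 := hL 0
          have hL1 := hL 1
          calc L 0 * L 1 * N ^ 2 / (2 * Real.pi) ^ 2
              = (L 0 * N / (2 * Real.pi)) * (L 1 * N / (2 * Real.pi)) := by field_simp
            _ ≤ _ := by gcongr
        have hp := Real.pi_pos
        have hL0 := hL 0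
        have hL1 := hL 1
        calc 16 * (m⁻¹) ^ 2 * (6 * a * S) * m = 16 * (6 * a * S) * m⁻¹ := by field_simp
          _ ≤ 16 * (6 * a * S) * (L 0 * L 1 * N ^ 2 / (2 * Real.pi) ^ 2)⁻¹ := by gcongr
          _ = smoothingConst L * (a * (B⁻¹ + N⁻¹)) := by
            rw [smoothingConst, hS]; field_simp; ring

end LocalSmoothing

/-! ### The difference characterisation of `H^{1/2}` -/

theorem lintegral_Ioi_inv_sq {r : ℝ} (hr : 0 < r) :
    ∫⁻ y in Ioi r, ENNReal.ofReal (1 / y ^ 2) = ENNReal.ofReal (1 / r) := by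
  have hint : IntegrableOn (fun y : ℝ => y ^ (-2 : ℝ)) (Ioi r) :=
    integrableOn_Ioi_rpow_of_lt (by norm_num) hr
  have h2 : ∀ y ∈ Ioi r, y ^ (-2 : ℝ) = 1 / y ^ 2 := fun y hy => by
    rw [Real.rpow_neg (hr.trans hy).le, one_div]; norm_cast
  have h3 : ∫⁻ y in Ioi r, ENNReal.ofReal (1 / y ^ 2) =
      ∫⁻ y in Ioi r, ENNReal.ofReal (y ^ (-2 : ℝ)) :=
    setLIntegral_congr_fun measurableSet_Ioi fun y hy => by simp only [h2 y hy]
  rw [h3, ← ofReal_integral_eq_lintegral_ofReal hint ?_, integral_Ioi_rpow_of_lt (by norm_num) hr]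
  · congr 1
    rw [show (-2 : ℝ) + 1 = -1 by norm_num, Real.rpow_neg_one]; ring
  · filter_upwards [ae_restrict_mem measurableSet_Ioi] with y hy
    exact Real.rpow_nonneg (hr.trans hy).le _

theorem lintegral_Ioi_le_of_le {f : ℝ → ℝ} {r c₁ c₂ : ℝ} (hr : 0 < r) (hc₁ : 0 ≤ c₁)
    (hc₂ : 0 ≤ c₂) (h1 : ∀ y ∈ Ioc 0 r, f y ≤ c₁) (h2 : ∀ y ∈ Ioi r, f y ≤ c₂ / y ^ 2) :
    ∫⁻ y in Ioi (0 : ℝ), ENNReal.ofReal (f y) ≤ ENNReal.ofReal (c₁ * r + c₂ / r) := by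
  rw [← Ioc_union_Ioi_eq_Ioi hr.le, ENNReal.ofReal_add (by positivity) (by positivity)]
  refine (lintegral_union_le _ _ _).trans (add_le_add ?_ ?_)
  · refine (setLIntegral_mono' measurableSet_Ioc fun y hy =>
      ENNReal.ofReal_le_ofReal (h1 y hy)).trans_eq ?_
    rw [setLIntegral_const, Real.volume_Ioc, sub_zero, ENNReal.ofReal_mul hc₁]
  · refine (setLIntegral_mono' measurableSet_Ioi fun y hy =>
      ENNReal.ofReal_le_ofReal ((h2 y hy).trans_eq (by ring :
        c₂ / y ^ 2 = c₂ * (1 / y ^ 2)))).trans_eq ?_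
    simp only [ENNReal.ofReal_mul hc₂]
    rw [lintegral_const_mul' _ _ ENNReal.ofReal_ne_top, lintegral_Ioi_inv_sq hr,
      ← ENNReal.ofReal_mul hc₂]
    congr 1; ring

theorem norm_exp_sub_one (x : ℝ) :
    ‖Complex.exp ((x : ℂ) * Complex.I) - 1‖ = 2 * |Real.sin (x / 2)| := by
  rw [mul_comm, Complex.norm_exp_I_mul_ofReal_sub_one, norm_mul, Real.norm_eq_abs]; simp

/-- The weight in the difference characterisation of `H^{1/2}`. -/
noncomputable def diffWeight (θ : ℝ) : ℝ≥0∞ :=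
  ∫⁻ y in Ioi (0 : ℝ), ENNReal.ofReal (‖Complex.exp (((θ * y : ℝ) : ℂ) * Complex.I) - 1‖ ^ 2 / y ^ 2)

/-- Split at y = 1/|θ|: below, |e^{iθy} - 1| ≤ |θ|y contributes |θ|; above, the trivial bound 2
contributes 4|θ|. -/
theorem diffWeight_le (θ : ℝ) : diffWeight θ ≤ ENNReal.ofReal (5 * |θ|) := by
  rcases eq_or_ne θ 0 with rfl | hθ
  · simp [diffWeight]
  have hθ0 : 0 < |θ| := abs_pos.2 hθ
  refine (lintegral_Ioi_le_of_le (r := 1 / |θ|) (c₁ := θ ^ 2) (c₂ := 4) (by positivity)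
    (by positivity) (by norm_num) ?_ ?_).trans_eq ?_
  · intro y hy
    rw [norm_exp_sub_one, div_le_iff₀ (by have := hy.1; positivity), ← mul_pow, ← sq_abs (θ * y)]
    refine pow_le_pow_left₀ (by positivity) ?_ 2
    have := Real.abs_sin_le_abs (x := θ * y / 2)
    rw [abs_div, abs_of_pos (by norm_num : (0 : ℝ) < 2)] at this
    linarith
  · intro y hy
    rw [norm_exp_sub_one]
    gcongr
    nlinarith [Real.abs_sin_le_one (θ * y / 2), abs_nonneg (Real.sin (θ * y / 2))]
  · congr 1
    rw [← sq_abs]; field_simp; norm_num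

/-- The range y ≤ 1/|θ| suffices: there Jordan's inequality and π ≤ 4 bound |e^{iθy} - 1| below by
|θ|y/2. -/
theorem le_diffWeight (θ : ℝ) : ENNReal.ofReal |θ| ≤ 4 * diffWeight θ := by
  rcases eq_or_ne θ 0 with rfl | hθ
  · simp
  have hθ0 : 0 < |θ| := abs_pos.2 hθ
  have h1 : ENNReal.ofReal (θ ^ 2 / 4 * (1 / |θ|)) ≤ diffWeight θ := by
    calc ENNReal.ofReal (θ ^ 2 / 4 * (1 / |θ|))
        = ∫⁻ y in Ioc 0 (1 / |θ|), ENNReal.ofReal (θ ^ 2 / 4) := by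
          rw [setLIntegral_const, Real.volume_Ioc, sub_zero, ENNReal.ofReal_mul (by positivity)]
      _ ≤ ∫⁻ y in Ioc 0 (1 / |θ|), ENNReal.ofReal
          (‖Complex.exp (((θ * y : ℝ) : ℂ) * Complex.I) - 1‖ ^ 2 / y ^ 2) := by
          refine setLIntegral_mono' measurableSet_Ioc fun y hy => ENNReal.ofReal_le_ofReal ?_
          have hy0 := hy.1
          have hy1 : |θ| * y ≤ 1 := by
            have := hy.2
            rw [le_div_iff₀ hθ0] at this; linarith
          rw [le_div_iff₀ (by positivity), norm_exp_sub_one]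
          have hpi := Real.pi_gt_three
          have hs : 2 / Real.pi * (|θ| * y / 2) ≤ Real.sin (|θ| * y / 2) :=
            Real.mul_le_sin (by positivity) (by linarith)
          have habs : |Real.sin (θ * y / 2)| = |Real.sin (|θ| * y / 2)| := by
            rcases abs_choice θ with h | h <;> rw [h]
            rw [neg_mul, neg_div, Real.sin_neg, abs_neg]
          have hs2 : 1 / 4 * (|θ| * y) ≤ |Real.sin (θ * y / 2)| := by
            rw [habs]
            refine le_trans ?_ (hs.trans (le_abs_self _))
            rw [show 2 / Real.pi * (|θ| * y / 2) = 1 / Real.pi * (|θ| * y) by ring]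
            refine mul_le_mul_of_nonneg_right ?_ (by positivity)
            exact one_div_le_one_div_of_le Real.pi_pos Real.pi_le_four
          have h3 : (1 / 4 * (|θ| * y)) ^ 2 ≤ |Real.sin (θ * y / 2)| ^ 2 := by gcongr
          rw [mul_pow, mul_pow, sq_abs] at h3
          linarith
      _ ≤ diffWeight θ := lintegral_mono_set Ioc_subset_Ioi_self
  calc ENNReal.ofReal |θ| = 4 * ENNReal.ofReal (θ ^ 2 / 4 * (1 / |θ|)) := by
        rw [show (4 : ℝ≥0∞) = ENNReal.ofReal 4 by simp, ← ENNReal.ofReal_mul (by norm_num)]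
        congr 1
        rw [← sq_abs θ]; field_simp
    _ ≤ _ := mul_le_mul_right h1 _

section Weights

variable (L : Fin 2 → ℝ)

/-- The weight `⟨ξ⟩` of `H^{1/2}`. -/
noncomputable def japanese (n : Fin 2 → ℤ) : ℝ≥0∞ :=
  ENNReal.ofReal ((1 + ‖freq L n‖ ^ 2) ^ (1 / 2 : ℝ))

theorem norm_freq_le_japanese (n : Fin 2 → ℤ) : ENNReal.ofReal ‖freq L n‖ ≤ japanese L n := by
  refine ENNReal.ofReal_le_ofReal ?_
  rw [← Real.sqrt_eq_rpow]
  exact Real.le_sqrt_of_sq_le (by linarith)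

theorem one_le_japanese (n : Fin 2 → ℤ) : 1 ≤ japanese L n := by
  refine ENNReal.one_le_ofReal.2 (Real.one_le_rpow ?_ (by norm_num))
  have : 0 ≤ ‖freq L n‖ ^ 2 := by positivity
  linarith

/-- As ⟨ξ⟩ ≤ 1 + |ξ₁| + |ξ₂|, differences in the two coordinate directions together with the L² norm
control H^{1/2}. -/
theorem japanese_le (n : Fin 2 → ℤ) :
    japanese L n ≤ 1 + ∑ i, 4 * diffWeight (freq L n i) := by
  calc japanese L n ≤ ENNReal.ofReal (1 + ∑ i, |freq L n i|) := by
        refine ENNReal.ofReal_le_ofReal ?_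
        rw [← Real.sqrt_eq_rpow, Real.sqrt_le_left (by positivity), norm_freq_sq]
        simp only [Fin.sum_univ_two]
        nlinarith [abs_nonneg (freq L n 0), abs_nonneg (freq L n 1), sq_abs (freq L n 0),
          sq_abs (freq L n 1), mul_nonneg (abs_nonneg (freq L n 0)) (abs_nonneg (freq L n 1))]
    _ = 1 + ∑ i, ENNReal.ofReal |freq L n i| := by
        rw [ENNReal.ofReal_add (by norm_num) (by positivity), ENNReal.ofReal_one,
          ENNReal.ofReal_sum_of_nonneg fun i _ => abs_nonneg _]
    _ ≤ _ := by gcongr; exact le_diffWeight _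

theorem diffWeight_le_japanese (n : Fin 2 → ℤ) (i : Fin 2) :
    diffWeight (freq L n i) ≤ 5 * japanese L n := by
  refine (diffWeight_le _).trans ?_
  rw [ENNReal.ofReal_mul (by norm_num)]
  have : |freq L n i| ≤ ‖freq L n‖ := PiLp.norm_apply_le (freq L n) i
  exact mul_le_mul' (by simp)
    ((ENNReal.ofReal_le_ofReal this).trans (norm_freq_le_japanese L n))

variable {L}

/-- The translation by `y` in the `i`-th direction. -/
noncomputable def shift (i : Fin 2) (y : ℝ) : Torus L := Pi.single i (y : AddCircle (L i))

theorem character_shift (n : Fin 2 → ℤ) (i : Fin 2) (y : ℝ) :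
    character L n (shift i y) = Complex.exp (((freq L n i * y : ℝ) : ℂ) * Complex.I) := by
  rw [character_apply, Finset.prod_eq_single i]
  · rw [shift, Pi.single_eq_same, fourier_coe_apply, freq_apply]
    congr 1; push_cast; ring
  · intro j _ hj
    rw [shift, Pi.single_eq_of_ne hj, fourier_eval_zero]
  · simp

/-- Summation of differences over all translations produces the weight `diffWeight`. -/
theorem tsum_diffWeight_mul (i : Fin 2) (α : (Fin 2 → ℤ) → ℝ≥0∞) :
    ∑' n, diffWeight (freq L n i) * α n = ∫⁻ y in Ioi (0 : ℝ), ENNReal.ofReal (1 / y ^ 2) *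
      ∑' n, ‖character L n (shift i y) - 1‖ₑ ^ 2 * α n := by
  have h : ∀ y n, ENNReal.ofReal (1 / y ^ 2) * (‖character L n (shift i y) - 1‖ₑ ^ 2 * α n) =
      ENNReal.ofReal (‖Complex.exp (((freq L n i * y : ℝ) : ℂ) * Complex.I) - 1‖ ^ 2 / y ^ 2) *
        α n := by
    intro y n
    rw [character_shift, ← ofReal_norm, ← ENNReal.ofReal_pow (norm_nonneg _), ← mul_assoc,
      ← ENNReal.ofReal_mul (by positivity)]
    congr 2; ring
  simp only [← ENNReal.tsum_mul_left, h]
  have hm : ∀ n, Measurable fun y : ℝ => ENNReal.ofReal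
      (‖Complex.exp (((freq L n i * y : ℝ) : ℂ) * Complex.I) - 1‖ ^ 2 / y ^ 2) := fun n => by
    fun_prop
  rw [lintegral_tsum fun n => ((hm n).mul_const _).aemeasurable]
  refine tsum_congr fun n => ?_
  rw [lintegral_mul_const _ (hm n), diffWeight]

theorem measurableSet_torusAbs_le (r : ℝ) : MeasurableSet {x : Torus L | torusAbs x ≤ r} := by
  refine measurableSet_le ?_ measurable_const
  unfold torusAbs; fun_prop

end Weights

theorem ofReal_mul_mul {p : ℝ} (hp : 0 ≤ p) (q : ℝ) (E : ℝ≥0∞) :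
    ENNReal.ofReal p * (ENNReal.ofReal q * E) = ENNReal.ofReal (p * q) * E := by
  rw [← mul_assoc, ← ENNReal.ofReal_mul hp]

theorem norm_conjIf (σ : Bool) (z : ℂ) : ‖conjIf σ z‖ = ‖z‖ := by
  unfold conjIf; split_ifs <;> simp

theorem conjIf_sub (σ : Bool) (z w : ℂ) : conjIf σ (z - w) = conjIf σ z - conjIf σ w := by
  unfold conjIf; split_ifs <;> simp

theorem continuous_conjIf (σ : Bool) : Continuous (conjIf σ) := by
  unfold conjIf; split_ifs <;> fun_prop

/-! ### The L²_t H^{1/2} norm of a concentrated multiplier times a free solution -/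

section Product

variable {L : Fin 2 → ℝ} [∀ i, Fact (0 < L i)]

/-- The product of multipliers `W` with the free solution with data `g` and its conjugate. -/
noncomputable def potentialMul (W : Bool → ℝ → Torus L → ℂ) (g : L2 L) (t : ℝ) (x : Torus L) : ℂ :=
  ∑ τ, W τ t x * conjIf τ ((schr L t g : Torus L → ℂ) x)

theorem memLp_conjIf {F : Torus L → ℂ} (hF : MemLp F 2 (haar L)) (τ : Bool) :
    MemLp (fun x => conjIf τ (F x)) 2 (haar L) :=
  MemLp.of_le hF ((continuous_conjIf τ).comp_aestronglyMeasurable hF.1)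
    (ae_of_all _ fun _ => (norm_conjIf _ _).le)

theorem memLp_potentialMul {W : Bool → ℝ → Torus L → ℂ} {t : ℝ} (hW : ∀ τ, Continuous (W τ t))
    (g : L2 L) : MemLp (potentialMul W g t) 2 (haar L) :=
  memLp_finsetSum _ fun τ _ => memLp_continuous_mul (hW τ) (memLp_conjIf (Lp.memLp _) τ)

theorem lintegral_schr (g : L2 L) (t : ℝ) :
    ∫⁻ x, ‖(schr L t g : Torus L → ℂ) x‖ₑ ^ 2 ∂(haar L) = ∑' n, ‖coeff L g n‖ₑ ^ 2 := by
  rw [← enorm_sq_eq_lintegral, ← tsum_enorm_coeff_sq]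
  refine tsum_congr fun n => ?_
  rw [coeff_schr, enorm_mul, ← ofReal_norm (phase L t n), norm_phase]
  simp

/-- The hypotheses on the multipliers: size `A N²`, support in `|t| ≤ N⁻²`, `|x| ≤ N⁻¹`, and
Lipschitz constant `A N³`. -/
structure IsConcentrated (A N : ℝ) (W : Bool → ℝ → Torus L → ℂ) : Prop where
  cont : ∀ τ, ∀ t ∈ Ioo (-1 : ℝ) 1, Continuous (W τ t)
  bound : ∀ τ, ∀ t ∈ Ioo (-1 : ℝ) 1, ∀ x, ‖W τ t x‖ ≤ A * N ^ 2
  supp : ∀ τ, ∀ t ∈ Ioo (-1 : ℝ) 1, ∀ x, W τ t x ≠ 0 →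
    t ∈ Icc (-(N ^ 2)⁻¹) (N ^ 2)⁻¹ ∧ torusAbs x ≤ N⁻¹
  lip : ∀ τ, ∀ t ∈ Ioo (-1 : ℝ) 1, ∀ (x : Torus L) i y, 0 < y →
    ‖W τ t (x + shift i y) - W τ t x‖ ≤ A * (N ^ 3 * y)

variable {A N B : ℝ} {W : Bool → ℝ → Torus L → ℂ} {g : L2 L}

theorem potentialMul_eq_zero (hW : IsConcentrated A N W) {t : ℝ} (ht : t ∈ Ioo (-1 : ℝ) 1)
    (ht' : t ∉ Icc (-(N ^ 2)⁻¹) (N ^ 2)⁻¹) (x : Torus L) : potentialMul W g t x = 0 := by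
  refine Finset.sum_eq_zero fun τ _ => ?_
  have : W τ t x = 0 := by
    by_contra h
    exact ht' (hW.supp τ t ht x h).1
  rw [this, zero_mul]

theorem setLIntegral_Ioo_le {a : ℝ} {f φ : ℝ → ℝ≥0∞}
    (h0 : ∀ t ∈ Ioo (-1 : ℝ) 1, t ∉ Icc (-a) a → f t = 0)
    (h1 : ∀ t ∈ Ioo (-1 : ℝ) 1, t ∈ Icc (-a) a → f t ≤ φ t) :
    ∫⁻ t in Ioo (-1 : ℝ) 1, f t ≤ ∫⁻ t in Icc (-a) a, φ t := by
  rw [← lintegral_indicator measurableSet_Icc]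
  refine le_trans (setLIntegral_mono' measurableSet_Ioo fun t ht => ?_)
    (setLIntegral_le_lintegral _ _)
  by_cases h : t ∈ Icc (-a) a
  · rw [indicator_of_mem h]; exact h1 t ht h
  · rw [h0 t ht h]; exact zero_le

theorem sum_bool_le {f : Bool → ℝ} {c : ℝ} (h : ∀ τ, f τ ≤ c) : ∑ τ, f τ ≤ 2 * c := by
  rw [Fintype.sum_bool]; linarith [h true, h false]

theorem enorm_sq_le_ofReal {z : ℂ} {r : ℝ} (h : ‖z‖ ≤ r) : ‖z‖ₑ ^ 2 ≤ ENNReal.ofReal (r ^ 2) := by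
  rw [← ofReal_norm, ← ENNReal.ofReal_pow (norm_nonneg _)]
  exact ENNReal.ofReal_le_ofReal (pow_le_pow_left₀ (norm_nonneg _) h 2)

theorem ofReal_sq_norm (z : ℂ) : ENNReal.ofReal (‖z‖ ^ 2) = ‖z‖ₑ ^ 2 := by
  rw [ENNReal.ofReal_pow (norm_nonneg _), ofReal_norm]

/-- The squared size N⁴ of the multipliers meets the local smoothing factor N⁻²(B⁻¹ + N⁻¹). -/
theorem lintegral_potentialMul_le (hN : 1 ≤ N) (hB : 2 ≤ B)
    (hW : IsConcentrated A N W) (hg : ∀ n, coeff L g n ≠ 0 → B * N ≤ ‖freq L n‖) :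
    ∫⁻ t in Ioo (-1 : ℝ) 1, ∫⁻ x, ‖potentialMul W g t x‖ₑ ^ 2 ∂(haar L) ≤
      ENNReal.ofReal (A ^ 2 * N ^ 2 * (B⁻¹ + N⁻¹) * (4 * smoothingConst L)) *
        ∑' n, ‖coeff L g n‖ₑ ^ 2 := by
  have hN0 : 0 < N := by linarith
  have hB0 : 0 < B := by linarith
  have hpt : ∀ t ∈ Ioo (-1 : ℝ) 1, ∫⁻ x, ‖potentialMul W g t x‖ₑ ^ 2 ∂(haar L) ≤
      ENNReal.ofReal (4 * A ^ 2 * N ^ 4) * ∫⁻ x in {x : Torus L | torusAbs x ≤ N⁻¹},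
        ‖(schr L t g : Torus L → ℂ) x‖ₑ ^ 2 ∂(haar L) := by
    intro t ht
    rw [← lintegral_const_mul' _ _ ENNReal.ofReal_ne_top,
      ← lintegral_indicator (measurableSet_torusAbs_le _)]
    refine lintegral_mono fun x => ?_
    by_cases hx : torusAbs x ≤ N⁻¹
    · rw [indicator_of_mem (by exact hx), ← ofReal_sq_norm ((schr L t g : Torus L → ℂ) x),
        ← ENNReal.ofReal_mul (by positivity)]
      refine (enorm_sq_le_ofReal (r := 2 * (A * N ^ 2 * ‖(schr L t g : Torus L → ℂ) x‖)) ?_).trans_eq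
        (by congr 1; ring)
      refine (norm_sum_le _ _).trans (sum_bool_le fun τ => ?_)
      rw [norm_mul, norm_conjIf]
      exact mul_le_mul_of_nonneg_right (hW.bound τ t ht x) (norm_nonneg _)
    · rw [indicator_of_notMem (by exact hx), potentialMul, Finset.sum_eq_zero]
      · simp
      · intro τ _
        have : W τ t x = 0 := by
          by_contra h; exact hx (hW.supp τ t ht x h).2
        rw [this, zero_mul]
  refine (setLIntegral_Ioo_le (a := (N ^ 2)⁻¹) (fun t ht ht' => ?_)
    (fun t ht _ => hpt t ht)).trans ?_
  · simp [potentialMul_eq_zero hW ht ht']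
  · rw [lintegral_const_mul' _ _ ENNReal.ofReal_ne_top]
    refine (mul_le_mul_right (lintegral_free_solution_le hN hB hg
      (fun t => Lp.memLp (schr L t g)) fun t n => coeff_schr L t g n) _).trans_eq ?_
    rw [← mul_assoc, ← ENNReal.ofReal_mul (by positivity)]
    congr 2
    field_simp

/-- A discrete Leibniz rule. Where the multiplier is differenced, only conservation of mass and the
length of the time window are used. Where the solution is differenced, W stays at the unshifted
point, so the localisation survives and local smoothing applies to the difference, with data
(e^{iξ·y} - 1) ĝ. -/
theorem lintegral_potentialMul_diff_le (hA : 0 ≤ A) (hN : 1 ≤ N) (hB : 2 ≤ B)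
    (hW : IsConcentrated A N W) (hg : ∀ n, coeff L g n ≠ 0 → B * N ≤ ‖freq L n‖) (i : Fin 2) {y : ℝ}
    (hy : 0 < y) :
    ∫⁻ t in Ioo (-1 : ℝ) 1,
      ∫⁻ x, ‖potentialMul W g t (x + shift i y) - potentialMul W g t x‖ₑ ^ 2 ∂(haar L) ≤
      ENNReal.ofReal (16 * A ^ 2 * (N ^ 2)⁻¹ * (min (N ^ 3 * y) (2 * N ^ 2)) ^ 2) *
          ∑' n, ‖coeff L g n‖ₑ ^ 2 +
        ENNReal.ofReal (A ^ 2 * N ^ 2 * (B⁻¹ + N⁻¹) * (8 * smoothingConst L)) *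
          ∑' n, ‖character L n (shift i y) - 1‖ₑ ^ 2 * ‖coeff L g n‖ₑ ^ 2 := by
  have hN0 : 0 < N := by linarith
  have hB0 : 0 < B := by linarith
  set M := min (N ^ 3 * y) (2 * N ^ 2) with hM
  have hM0 : 0 ≤ M := by positivity
  set u : ℝ → Torus L → ℂ := fun t x => (schr L t g : Torus L → ℂ) x with hu
  have hum : ∀ t, MemLp (u t) 2 (haar L) := fun t => Lp.memLp (schr L t g)
  have hdW : ∀ τ, ∀ t ∈ Ioo (-1 : ℝ) 1, ∀ x, ‖W τ t (x + shift i y) - W τ t x‖ ≤ A * M := by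
    intro τ t ht x
    rw [hM, mul_min_of_nonneg _ _ hA]
    refine le_min (hW.lip τ t ht x i y hy) ((norm_sub_le _ _).trans ?_)
    linarith [hW.bound τ t ht x, hW.bound τ t ht (x + shift i y)]
  have hpt : ∀ t ∈ Ioo (-1 : ℝ) 1,
      ∫⁻ x, ‖potentialMul W g t (x + shift i y) - potentialMul W g t x‖ₑ ^ 2 ∂(haar L) ≤
      ENNReal.ofReal (8 * A ^ 2 * M ^ 2) * ∑' n, ‖coeff L g n‖ₑ ^ 2 +
        ENNReal.ofReal (8 * A ^ 2 * N ^ 4) * ∫⁻ x in {x : Torus L | torusAbs x ≤ N⁻¹},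
          ‖u t (x + shift i y) - u t x‖ₑ ^ 2 ∂(haar L) := by
    intro t ht
    have htr : ∫⁻ x, ‖u t (x + shift i y)‖ₑ ^ 2 ∂(haar L) = ∑' n, ‖coeff L g n‖ₑ ^ 2 := by
      rw [lintegral_add_right_eq_self (μ := haar L) (fun x => ‖u t x‖ₑ ^ 2)]
      exact lintegral_schr g t
    have hmeas : AEMeasurable (fun x => ENNReal.ofReal (8 * A ^ 2 * M ^ 2) *
        ‖u t (x + shift i y)‖ₑ ^ 2) (haar L) :=
      ((memLp_translate (hum t) _).1.enorm.pow_const 2).const_mul _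
    rw [← htr, ← lintegral_const_mul' _ _ ENNReal.ofReal_ne_top,
      ← lintegral_const_mul' _ _ ENNReal.ofReal_ne_top,
      ← lintegral_indicator (measurableSet_torusAbs_le _), ← lintegral_add_left' hmeas]
    refine lintegral_mono fun x => ?_
    have hsplit : potentialMul W g t (x + shift i y) - potentialMul W g t x =
        ∑ τ, ((W τ t (x + shift i y) - W τ t x) * conjIf τ (u t (x + shift i y)) +
          W τ t x * conjIf τ (u t (x + shift i y) - u t x)) := by
      simp only [potentialMul, ← Finset.sum_sub_distrib, conjIf_sub]
      exact Finset.sum_congr rfl fun τ _ => by ring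
    have h1 : ∀ τ, ‖(W τ t (x + shift i y) - W τ t x) * conjIf τ (u t (x + shift i y))‖ ≤
        A * M * ‖u t (x + shift i y)‖ := fun τ => by
      rw [norm_mul, norm_conjIf]
      exact mul_le_mul_of_nonneg_right (hdW τ t ht x) (norm_nonneg _)
    by_cases hx : torusAbs x ≤ N⁻¹
    · rw [indicator_of_mem (by exact hx), ← ofReal_sq_norm (u t (x + shift i y)),
        ← ofReal_sq_norm (u t (x + shift i y) - u t x), ← ENNReal.ofReal_mul (by positivity), ← ENNReal.ofReal_mul (by positivity),
        ← ENNReal.ofReal_add (by positivity) (by positivity)]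
      refine (enorm_sq_le_ofReal (r := 2 * (A * M * ‖u t (x + shift i y)‖ +
        A * N ^ 2 * ‖u t (x + shift i y) - u t x‖)) ?_).trans (ENNReal.ofReal_le_ofReal ?_)
      · rw [hsplit]
        refine (norm_sum_le _ _).trans (sum_bool_le fun τ => ?_)
        refine (norm_add_le _ _).trans (add_le_add (h1 τ) ?_)
        rw [norm_mul, norm_conjIf]
        exact mul_le_mul_of_nonneg_right (hW.bound τ t ht x) (norm_nonneg _)
      · nlinarith [sq_nonneg (A * M * ‖u t (x + shift i y)‖ -
          A * N ^ 2 * ‖u t (x + shift i y) - u t x‖)]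
    -- Outside the ball W vanishes at x but perhaps not at the shifted point, so the term with the
    -- differenced multiplier remains.
    · rw [indicator_of_notMem (by exact hx), add_zero, ← ofReal_sq_norm (u t _),
        ← ENNReal.ofReal_mul (by positivity)]
      refine (enorm_sq_le_ofReal (r := 2 * (A * M * ‖u t (x + shift i y)‖)) ?_).trans
        (ENNReal.ofReal_le_ofReal ?_)
      · rw [hsplit]
        refine (norm_sum_le _ _).trans (sum_bool_le fun τ => ?_)
        have h2 : W τ t x = 0 := by
          by_contra h; exact hx (hW.supp τ t ht x h).2
        rw [h2, zero_mul, add_zero]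
        have := h1 τ
        rwa [h2] at this
      · nlinarith [sq_nonneg (A * M * ‖u t (x + shift i y)‖)]
  refine (setLIntegral_Ioo_le (a := (N ^ 2)⁻¹) (fun t ht ht' => ?_)
    (fun t ht _ => hpt t ht)).trans ?_
  · simp [potentialMul_eq_zero hW ht ht']
  rw [lintegral_add_left measurable_const, setLIntegral_const,
    lintegral_const_mul' _ _ ENNReal.ofReal_ne_top, Real.volume_Icc]
  refine add_le_add (le_of_eq ?_) ?_
  · rw [mul_right_comm, ← ENNReal.ofReal_mul (by positivity)]
    congr 2; ring
  · have hLS := lintegral_free_solution_le hN hB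
      (b := fun n => (character L n (shift i y) - 1) * coeff L g n)
      (fun n hn => hg n (right_ne_zero_of_mul hn))
      (V := fun t x => u t (x + shift i y) - u t x)
      (fun t => (memLp_translate (hum t) _).sub (hum t)) (fun t n => by
        rw [fcoef_sub (memLp_translate (hum t) _) (hum t), fcoef_translate]
        have : fcoef L (u t) n = phase L t n * coeff L g n := coeff_schr L t g n
        rw [this]; ring)
    refine (mul_le_mul_right hLS _).trans_eq ?_
    rw [← mul_assoc, ← ENNReal.ofReal_mul (by positivity)]
    simp only [enorm_mul, mul_pow]
    congr 2
    field_simp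

/-- The `L²_t H^{1/2}` estimate for the product. -/
theorem sum_japanese_mul_lintegral_le (hA : 0 ≤ A) (hN : 1 ≤ N) (hB : 2 ≤ B)
    (hW : IsConcentrated A N W) (hg : ∀ n, coeff L g n ≠ 0 → B * N ≤ ‖freq L n‖)
    (hmeas : ∀ n, AEMeasurable (fun t => fcoef L (potentialMul W g t) n)
      (volume.restrict (Ioo (-1) 1))) :
    ∑' n, japanese L n * ∫⁻ t in Ioo (-1 : ℝ) 1, ‖fcoef L (potentialMul W g t) n‖ₑ ^ 2 ≤
      ENNReal.ofReal ((640 + 324 * smoothingConst L) * (A ^ 2 * N ^ 2 * (B⁻¹ + N⁻¹))) *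
        ∑' n, japanese L n * ‖coeff L g n‖ₑ ^ 2 := by
  have hN0 : 0 < N := by linarith
  have hB0 : 0 < B := by linarith
  have hK0 := smoothingConst_nonneg (L := L)
  set K := smoothingConst L with hK
  set D := A ^ 2 * N ^ 2 * (B⁻¹ + N⁻¹) with hD
  have hD0 : 0 ≤ D := by positivity
  set α : (Fin 2 → ℤ) → ℝ≥0∞ := fun n =>
    ∫⁻ t in Ioo (-1 : ℝ) 1, ‖fcoef L (potentialMul W g t) n‖ₑ ^ 2 with hα
  set E := ∑' n, japanese L n * ‖coeff L g n‖ₑ ^ 2 with hE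
  set E₀ := ∑' n, ‖coeff L g n‖ₑ ^ 2 with hE₀
  have hmem : ∀ t ∈ Ioo (-1 : ℝ) 1, MemLp (potentialMul W g t) 2 (haar L) := fun t ht =>
    memLp_potentialMul (fun τ => hW.cont τ t ht) g
  have hE₀E : E₀ ≤ E := ENNReal.tsum_le_tsum fun n =>
    le_mul_of_one_le_left zero_le (one_le_japanese L n)
  have hE₀E' : ENNReal.ofReal (B * N) * E₀ ≤ E := by
    rw [hE₀, ← ENNReal.tsum_mul_left]
    refine ENNReal.tsum_le_tsum fun n => ?_
    by_cases h : coeff L g n = 0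
    · simp [h]
    · exact mul_le_mul_left ((ENNReal.ofReal_le_ofReal (hg n h)).trans
        (norm_freq_le_japanese L n)) _
  have hlow : ∑' n, α n ≤ ENNReal.ofReal (4 * K * D) * E := by
    calc ∑' n, α n = ∫⁻ t in Ioo (-1 : ℝ) 1, ∑' n, ‖fcoef L (potentialMul W g t) n‖ₑ ^ 2 :=
          (lintegral_tsum fun n => (hmeas n).enorm.pow_const 2).symm
      _ = ∫⁻ t in Ioo (-1 : ℝ) 1, ∫⁻ x, ‖potentialMul W g t x‖ₑ ^ 2 ∂(haar L) :=
          setLIntegral_congr_fun measurableSet_Ioo fun t ht =>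
            (lintegral_enorm_sq_eq_tsum (hmem t ht)).symm
      _ ≤ _ := lintegral_potentialMul_le hN hB hW hg
      _ ≤ _ := by
          rw [mul_comm D]
          exact mul_le_mul_right hE₀E _
  have hdiff : ∀ i : Fin 2, ∑' n, diffWeight (freq L n i) * α n ≤
      ENNReal.ofReal ((80 + 40 * K) * D) * E := by
    intro i
    rw [tsum_diffWeight_mul]
    have hy : ∀ y ∈ Ioi (0 : ℝ), ∑' n, ‖character L n (shift i y) - 1‖ₑ ^ 2 * α n ≤
        ENNReal.ofReal (16 * A ^ 2 * (N ^ 2)⁻¹ * (min (N ^ 3 * y) (2 * N ^ 2)) ^ 2) * E₀ +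
        ENNReal.ofReal (D * (8 * K)) *
          ∑' n, ‖character L n (shift i y) - 1‖ₑ ^ 2 * ‖coeff L g n‖ₑ ^ 2 := by
      intro y hy
      refine le_trans (le_of_eq ?_) (lintegral_potentialMul_diff_le hA hN hB hW hg i hy)
      simp only [hα]
      have h1 : ∀ n, ‖character L n (shift i y) - 1‖ₑ ^ 2 *
          ∫⁻ t in Ioo (-1 : ℝ) 1, ‖fcoef L (potentialMul W g t) n‖ₑ ^ 2 =
          ∫⁻ t in Ioo (-1 : ℝ) 1, ‖character L n (shift i y) - 1‖ₑ ^ 2 *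
            ‖fcoef L (potentialMul W g t) n‖ₑ ^ 2 := fun n =>
        (lintegral_const_mul' _ _ (by simp)).symm
      simp only [h1]
      rw [← lintegral_tsum fun n => ((hmeas n).enorm.pow_const 2).const_mul _]
      refine setLIntegral_congr_fun measurableSet_Ioo fun t ht => ?_
      refine Eq.trans ?_
        (lintegral_enorm_sq_eq_tsum ((memLp_translate (hmem t ht) (shift i y)).sub (hmem t ht))).symm
      refine tsum_congr fun n => ?_
      have h2 := fcoef_sub (memLp_translate (hmem t ht) (shift i y)) (hmem t ht) n
      rw [fcoef_translate] at h2
      have h3 : fcoef L ((fun x => potentialMul W g t (x + shift i y)) - potentialMul W g t) n =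
          (character L n (shift i y) - 1) * fcoef L (potentialMul W g t) n := by
        rw [sub_mul, one_mul]; exact h2
      rw [h3, enorm_mul, mul_pow]
    have hm1 : Measurable fun y : ℝ => ENNReal.ofReal
        (16 * A ^ 2 * (N ^ 2)⁻¹ * (min (N ^ 3 * y) (2 * N ^ 2)) ^ 2 / y ^ 2) := by fun_prop
    calc ∫⁻ y in Ioi (0 : ℝ), ENNReal.ofReal (1 / y ^ 2) *
          ∑' n, ‖character L n (shift i y) - 1‖ₑ ^ 2 * α n
        ≤ ∫⁻ y in Ioi (0 : ℝ), (ENNReal.ofReal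
            (16 * A ^ 2 * (N ^ 2)⁻¹ * (min (N ^ 3 * y) (2 * N ^ 2)) ^ 2 / y ^ 2) * E₀ +
          ENNReal.ofReal (D * (8 * K)) * (ENNReal.ofReal (1 / y ^ 2) *
            ∑' n, ‖character L n (shift i y) - 1‖ₑ ^ 2 * ‖coeff L g n‖ₑ ^ 2)) := by
          refine setLIntegral_mono' measurableSet_Ioi fun y hy' => ?_
          refine (mul_le_mul_right (hy y hy') _).trans_eq ?_
          rw [mul_add, ofReal_mul_mul (by positivity), mul_left_comm (ENNReal.ofReal (1 / y ^ 2))]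
          congr 3
          ring
      _ = ENNReal.ofReal (D * (8 * K)) * ∑' n, diffWeight (freq L n i) * ‖coeff L g n‖ₑ ^ 2 +
          (∫⁻ y in Ioi (0 : ℝ), ENNReal.ofReal
            (16 * A ^ 2 * (N ^ 2)⁻¹ * (min (N ^ 3 * y) (2 * N ^ 2)) ^ 2 / y ^ 2)) * E₀ := by
          rw [lintegral_add_left (hm1.mul_const _), lintegral_mul_const _ hm1,
            lintegral_const_mul' _ _ ENNReal.ofReal_ne_top, tsum_diffWeight_mul, add_comm]
      _ ≤ ENNReal.ofReal (D * (8 * K)) * (5 * E) +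
          ENNReal.ofReal (16 * A ^ 2 * (N ^ 2)⁻¹ * N ^ 6 * N⁻¹ +
            16 * A ^ 2 * (N ^ 2)⁻¹ * (2 * N ^ 2) ^ 2 / N⁻¹) * E₀ := by
          refine add_le_add (mul_le_mul_right ?_ _) (mul_le_mul_left ?_ _)
          · rw [hE, ← ENNReal.tsum_mul_left]
            refine ENNReal.tsum_le_tsum fun n => ?_
            rw [← mul_assoc]
            exact mul_le_mul_left (diffWeight_le_japanese L n i) _
          -- Split at y = N⁻¹, the scale of W, where the Lipschitz bound N³y and the size bound 2N²
          -- are comparable.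
          · refine lintegral_Ioi_le_of_le (by positivity) (by positivity) (by positivity) ?_ ?_
            · intro y hy'
              have hy0 := hy'.1
              rw [div_le_iff₀ (by positivity)]
              have : (min (N ^ 3 * y) (2 * N ^ 2)) ^ 2 ≤ (N ^ 3 * y) ^ 2 := by
                have := min_le_left (N ^ 3 * y) (2 * N ^ 2)
                gcongr
              calc _ ≤ 16 * A ^ 2 * (N ^ 2)⁻¹ * (N ^ 3 * y) ^ 2 := by gcongr
                _ = _ := by ring
            · intro y hy'
              have hy0 : 0 < y := (inv_pos.2 hN0).trans hy'
              have : (min (N ^ 3 * y) (2 * N ^ 2)) ^ 2 ≤ (2 * N ^ 2) ^ 2 := by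
                have := min_le_right (N ^ 3 * y) (2 * N ^ 2)
                gcongr
              gcongr
      -- The y-integral gives (16 + 64) A² N³ E₀. Writing N³ = N² B⁻¹ · BN, the factor BN is
      -- absorbed by the H^{1/2} norm, because g has only frequencies beyond BN.
      _ = ENNReal.ofReal (40 * K * D) * E +
          ENNReal.ofReal (80 * A ^ 2 * N ^ 2 * B⁻¹) * (ENNReal.ofReal (B * N) * E₀) := by
          rw [show (5 : ℝ≥0∞) = ENNReal.ofReal 5 by simp, ofReal_mul_mul (by positivity),
            ofReal_mul_mul (by positivity)]
          congr 3
          · ring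
          · field_simp; ring
      _ ≤ ENNReal.ofReal (40 * K * D) * E + ENNReal.ofReal (80 * D) * E := by
          refine add_le_add le_rfl (mul_le_mul' (ENNReal.ofReal_le_ofReal ?_) hE₀E')
          rw [hD, mul_add]
          have : 0 ≤ A ^ 2 * N ^ 2 * N⁻¹ := by positivity
          nlinarith
      _ = _ := by
          rw [← add_mul, ← ENNReal.ofReal_add (by positivity) (by positivity)]
          congr 2; ring
  calc ∑' n, japanese L n * α n ≤ ∑' n, (1 + ∑ i, 4 * diffWeight (freq L n i)) * α n :=
        ENNReal.tsum_le_tsum fun n => mul_le_mul_left (japanese_le L n) _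
    _ = ∑' n, α n + ∑ i : Fin 2, 4 * ∑' n, diffWeight (freq L n i) * α n := by
        simp only [add_mul, one_mul, Finset.sum_mul, mul_assoc]
        rw [ENNReal.tsum_add, Summable.tsum_finsetSum fun i _ => ENNReal.summable]
        simp only [ENNReal.tsum_mul_left]
    _ ≤ ENNReal.ofReal (4 * K * D) * E +
          ∑ i : Fin 2, 4 * (ENNReal.ofReal ((80 + 40 * K) * D) * E) :=
        add_le_add hlow (Finset.sum_le_sum fun i _ => mul_le_mul_right (hdiff i) _)
    _ = _ := by
        rw [Fin.sum_univ_two, show (4 : ℝ≥0∞) = ENNReal.ofReal 4 by simp,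
          ofReal_mul_mul (by positivity), ← add_mul, ← add_mul,
          ← ENNReal.ofReal_add (by positivity) (by positivity),
          ← ENNReal.ofReal_add (by positivity) (by positivity)]
        congr 2; ring

end Product

/-! ### The quintic expression -/

section Quintic

/-- The factor of the quintic expression multiplying `conjIf τ b`. -/
noncomputable def quarticFactor (κ : (Fin 4 → Bool) → Bool → ℂ) (τ : Bool) (z : ℂ) : ℂ :=
  ∑ σ, κ σ τ * ∏ i, conjIf (σ i) z

theorem quintic_eq (κ : (Fin 4 → Bool) → Bool → ℂ) (a b : ℂ) :
    quintic κ a b = ∑ τ, quarticFactor κ τ a * conjIf τ b := by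
  rw [quintic, Finset.sum_comm]
  refine Finset.sum_congr rfl fun τ _ => ?_
  rw [quarticFactor, Finset.sum_mul]
  exact Finset.sum_congr rfl fun σ _ => by ring

theorem continuous_quarticFactor (κ : (Fin 4 → Bool) → Bool → ℂ) (τ : Bool) :
    Continuous (quarticFactor κ τ) :=
  continuous_finsetSum _ fun _ _ => continuous_const.mul
    (continuous_finsetProd _ fun _ _ => continuous_conjIf _)

/-- The sum of the absolute values of the coefficients. -/
noncomputable def coefSum (κ : (Fin 4 → Bool) → Bool → ℂ) : ℝ := ∑ σ, ∑ τ, ‖κ σ τ‖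

theorem coefSum_nonneg (κ : (Fin 4 → Bool) → Bool → ℂ) : 0 ≤ coefSum κ :=
  Finset.sum_nonneg fun _ _ => Finset.sum_nonneg fun _ _ => norm_nonneg _

theorem sum_norm_mul_le (κ : (Fin 4 → Bool) → Bool → ℂ) (τ : Bool) {c : ℝ}
    {f : (Fin 4 → Bool) → ℂ} (hf : ∀ σ, ‖f σ‖ ≤ c) : ‖∑ σ, κ σ τ * f σ‖ ≤ coefSum κ * c := by
  rw [coefSum, Finset.sum_mul]
  refine (norm_sum_le _ _).trans (Finset.sum_le_sum fun σ _ => ?_)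
  rw [norm_mul]
  refine mul_le_mul ?_ (hf σ) (norm_nonneg _) (Finset.sum_nonneg fun _ _ => norm_nonneg _)
  exact Finset.single_le_sum (f := fun τ => ‖κ σ τ‖) (fun _ _ => norm_nonneg _) (Finset.mem_univ τ)

theorem norm_quarticFactor_le (κ : (Fin 4 → Bool) → Bool → ℂ) (τ : Bool) {z : ℂ} {R : ℝ}
    (hz : ‖z‖ ≤ R) : ‖quarticFactor κ τ z‖ ≤ coefSum κ * R ^ 4 := by
  have hR : 0 ≤ R := (norm_nonneg z).trans hz
  refine sum_norm_mul_le κ τ fun σ => ?_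
  rw [norm_prod]
  simp only [norm_conjIf, Finset.prod_const, Finset.card_univ, Fintype.card_fin]
  gcongr

/-- Telescoping: the four factors are exchanged one at a time. -/
theorem norm_quarticFactor_sub_le (κ : (Fin 4 → Bool) → Bool → ℂ) (τ : Bool) {z w : ℂ} {R : ℝ}
    (hz : ‖z‖ ≤ R) (hw : ‖w‖ ≤ R) :
    ‖quarticFactor κ τ z - quarticFactor κ τ w‖ ≤ coefSum κ * (4 * R ^ 3 * ‖z - w‖) := by
  have hR : 0 ≤ R := (norm_nonneg z).trans hz
  simp only [quarticFactor, ← Finset.sum_sub_distrib, ← mul_sub]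
  refine sum_norm_mul_le κ τ fun σ => ?_
  have hd : ∀ i, ‖conjIf (σ i) z - conjIf (σ i) w‖ = ‖z - w‖ := fun i => by
    rw [← conjIf_sub, norm_conjIf]
  have hz' : ∀ i, ‖conjIf (σ i) z‖ ≤ R := fun i => by rwa [norm_conjIf]
  have hw' : ∀ i, ‖conjIf (σ i) w‖ ≤ R := fun i => by rwa [norm_conjIf]
  simp only [Fin.prod_univ_four]
  set z0 := conjIf (σ 0) z
  set z1 := conjIf (σ 1) z
  set z2 := conjIf (σ 2) z
  set z3 := conjIf (σ 3) z
  set w0 := conjIf (σ 0) w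
  set w1 := conjIf (σ 1) w
  set w2 := conjIf (σ 2) w
  set w3 := conjIf (σ 3) w
  have e : z0 * z1 * z2 * z3 - w0 * w1 * w2 * w3 = (z0 - w0) * (z1 * z2 * z3) +
      w0 * (z1 - w1) * (z2 * z3) + w0 * w1 * (z2 - w2) * z3 + w0 * w1 * w2 * (z3 - w3) := by ring
  have h0 : ‖(z0 - w0) * (z1 * z2 * z3)‖ ≤ ‖z - w‖ * (R * R * R) := by
    rw [norm_mul, norm_mul, norm_mul, hd 0]
    gcongr
    exacts [hz' 1, hz' 2, hz' 3]
  have h1 : ‖w0 * (z1 - w1) * (z2 * z3)‖ ≤ R * ‖z - w‖ * (R * R) := by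
    rw [norm_mul, norm_mul, norm_mul, hd 1]
    gcongr
    exacts [hw' 0, hz' 2, hz' 3]
  have h2 : ‖w0 * w1 * (z2 - w2) * z3‖ ≤ R * R * ‖z - w‖ * R := by
    rw [norm_mul, norm_mul, norm_mul, hd 2]
    gcongr
    exacts [hw' 0, hw' 1, hz' 3]
  have h3 : ‖w0 * w1 * w2 * (z3 - w3)‖ ≤ R * R * R * ‖z - w‖ := by
    rw [norm_mul, norm_mul, norm_mul, hd 3]
    gcongr
    exacts [hw' 0, hw' 1, hw' 2]
  rw [e]
  have h4 := norm_add₃_le (a := (z0 - w0) * (z1 * z2 * z3)) (b := w0 * (z1 - w1) * (z2 * z3))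
    (c := w0 * w1 * (z2 - w2) * z3)
  have h5 := norm_add_le ((z0 - w0) * (z1 * z2 * z3) + w0 * (z1 - w1) * (z2 * z3) +
    w0 * w1 * (z2 - w2) * z3) (w0 * w1 * w2 * (z3 - w3))
  linarith

end Quintic

/-! ### From gradient bounds on the plane to Lipschitz bounds on the torus -/

section Lift

variable {L : Fin 2 → ℝ}

/-- The projection of the plane onto the torus. -/
def proj (L : Fin 2 → ℝ) (x : EuclideanSpace ℝ (Fin 2)) : Torus L := fun i => (x i : AddCircle (L i))

theorem isOpenQuotientMap_proj : IsOpenQuotientMap (proj L) := by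
  have h1 : IsOpenQuotientMap (Pi.map fun (i : Fin 2) (r : ℝ) => (r : AddCircle (L i))) :=
    IsOpenQuotientMap.piMap fun i => QuotientAddGroup.isOpenQuotientMap_mk
  exact h1.comp (PiLp.homeomorph 2 fun _ : Fin 2 => ℝ).isOpenQuotientMap

theorem proj_add_single (x : EuclideanSpace ℝ (Fin 2)) (i : Fin 2) (y : ℝ) :
    proj L (x + y • EuclideanSpace.single i 1) = proj L x + shift i y := by
  ext j
  by_cases h : j = i
  · subst h
    simp [proj, shift]
  · simp [proj, shift, h]

/-- The mean value inequality along a lifted segment, valid for every y > 0 even if the segment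
winds around the torus. -/
theorem norm_sub_le_of_gradAbs_le {G : Torus L → ℂ} {c : ℝ} (hd : Differentiable ℝ (lift G))
    (hG : ∀ x, gradAbs G x ≤ c) (x : Torus L) (i : Fin 2) {y : ℝ} (hy : 0 < y) :
    ‖G (x + shift i y) - G x‖ ≤ c * y := by
  obtain ⟨z, rfl⟩ := isOpenQuotientMap_proj.surjective x
  rw [← proj_add_single]
  set e : EuclideanSpace ℝ (Fin 2) := EuclideanSpace.single i 1 with he
  have hder : ∀ s : ℝ, HasDerivAt (fun s : ℝ => lift G (z + s • e))
      (fderiv ℝ (lift G) (z + s • e) e) s := by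
    intro s
    have h1 : HasDerivAt (fun s : ℝ => z + s • e) e s := by
      simpa using ((hasDerivAt_id s).smul_const e).const_add z
    exact ((hd (z + s • e)).hasFDerivAt.comp_hasDerivAt s h1)
  have h := norm_image_sub_le_of_norm_deriv_le_segment' (a := 0) (b := y) (C := c)
    (fun s _ => (hder s).hasDerivWithinAt) (fun s _ => by
      refine le_trans ?_ (hG (z + s • e))
      apply Real.le_sqrt_of_sq_le
      exact Finset.single_le_sum
        (f := fun i => ‖fderiv ℝ (lift G) (z + s • e) (EuclideanSpace.single i 1)‖ ^ 2)
        (fun _ _ => by positivity) (Finset.mem_univ i)) y ⟨hy.le, le_rfl⟩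
  simp only [zero_smul, add_zero, sub_zero] at h
  exact h

theorem continuous_of_differentiable_lift {G : Torus L → ℂ} (hd : Differentiable ℝ (lift G)) :
    Continuous G :=
  isOpenQuotientMap_proj.isQuotientMap.continuous_iff.2 hd.continuous

/-- Powers of N: four factors N^{1/2} give N², and three of them with one gradient N^{3/2} give N³.
The constant 4 counts the factors a difference can fall on. -/
theorem isConcentrated_quarticFactor (κ : (Fin 4 → Bool) → Bool → ℂ) {N : ℝ} (hN : 1 ≤ N)
    {ω : ℝ → Torus L → ℂ} (hd : ∀ t ∈ Ioo (-1 : ℝ) 1, Differentiable ℝ (lift (ω t)))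
    (hb : ∀ t ∈ Ioo (-1 : ℝ) 1, ∀ x, ‖ω t x‖ ≤ N ^ (1 / 2 : ℝ))
    (hs : ∀ t ∈ Ioo (-1 : ℝ) 1, ∀ x, ω t x ≠ 0 → |t| ≤ (N ^ 2)⁻¹ ∧ torusAbs x ≤ N⁻¹)
    (hgr : ∀ t ∈ Ioo (-1 : ℝ) 1, ∀ x, gradAbs (ω t) x ≤ N ^ (1 + 1 / 2 : ℝ)) :
    IsConcentrated (4 * coefSum κ) N fun τ t x => quarticFactor κ τ (ω t x) := by
  have hN0 : 0 < N := by linarith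
  have hκ := coefSum_nonneg κ
  refine ⟨fun τ t ht => ?_, fun τ t ht x => ?_, fun τ t ht x hx => ?_, fun τ t ht x i y hy => ?_⟩
  · exact (continuous_quarticFactor κ τ).comp (continuous_of_differentiable_lift (hd t ht))
  · refine (norm_quarticFactor_le κ τ (hb t ht x)).trans ?_
    have h : (N ^ (1 / 2 : ℝ)) ^ 4 = N ^ 2 := by
      rw [← Real.rpow_natCast, ← Real.rpow_mul hN0.le, ← Real.rpow_natCast]; norm_num
    rw [h]
    have : 0 ≤ coefSum κ * N ^ 2 := by positivity
    linarith
  · have hω : ω t x ≠ 0 := by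
      intro h
      apply hx
      have := norm_quarticFactor_le κ τ (z := ω t x) (R := 0) (by rw [h, norm_zero])
      simpa using this
    exact ⟨abs_le.1 (hs t ht x hω).1, (hs t ht x hω).2⟩
  · refine (norm_quarticFactor_sub_le κ τ (hb t ht _) (hb t ht x)).trans ?_
    have h1 := norm_sub_le_of_gradAbs_le (hd t ht) (hgr t ht) x i hy
    have h2 : (N ^ (1 / 2 : ℝ)) ^ 3 * N ^ (1 + 1 / 2 : ℝ) = N ^ 3 := by
      rw [← Real.rpow_natCast, ← Real.rpow_mul hN0.le, ← Real.rpow_add hN0, ← Real.rpow_natCast]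
      norm_num
    calc coefSum κ * (4 * (N ^ (1 / 2 : ℝ)) ^ 3 * ‖ω t (x + shift i y) - ω t x‖)
        ≤ coefSum κ * (4 * (N ^ (1 / 2 : ℝ)) ^ 3 * (N ^ (1 + 1 / 2 : ℝ) * y)) := by gcongr
      _ = 4 * coefSum κ * ((N ^ (1 / 2 : ℝ)) ^ 3 * N ^ (1 + 1 / 2 : ℝ) * y) := by ring
      _ = _ := by rw [h2]

end Lift

/-! ### Measurability in time of the Fourier coefficients of the product -/

section Measurability

variable {L : Fin 2 → ℝ} [∀ i, Fact (0 < L i)]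

theorem hasSum_fcoef_mul {W : Torus L → ℂ} (hW : Continuous W) (v : L2 L) (n : Fin 2 → ℤ) :
    HasSum (fun k => (∫ x, conj (character L n x) * W x * character L k x ∂(haar L)) * coeff L v k)
      (fcoef L (fun x => W x * v x) n) := by
  let q : C(Torus L, ℂ) := ⟨fun x => character L n x * conj (W x), by fun_prop⟩
  have h := (characterBasis L).hasSum_inner_mul_inner (ContinuousMap.toLp 2 (haar L) ℂ q) v
  simp only [characterBasis_apply, ← coeff_eq_inner] at h
  have h1 : ∀ k, inner ℂ (ContinuousMap.toLp 2 (haar L) ℂ q) (characterLp L k) =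
      ∫ x, conj (character L n x) * W x * character L k x ∂(haar L) := fun k => by
    rw [ContinuousMap.inner_toLp]
    congr 1; ext x
    simp only [q, ContinuousMap.coe_mk, map_mul, Complex.conj_conj]
    ring
  have h2 : inner ℂ (ContinuousMap.toLp 2 (haar L) ℂ q) v = fcoef L (fun x => W x * v x) n := by
    rw [MeasureTheory.L2.inner_def]
    refine integral_congr_ae ?_
    filter_upwards [ContinuousMap.coeFn_toLp (p := 2) (𝕜 := ℂ) (haar L) q] with x hx
    rw [hx, RCLike.inner_apply]
    simp only [q, ContinuousMap.coe_mk, map_mul, Complex.conj_conj]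
    ring
  simpa only [h1, h2] using h

/-- The representatives of v t are chosen separately for each t and need not be jointly measurable.
Expanding v t in characters leaves only integrals of the jointly measurable W against characters,
times the coefficients of v t. -/
theorem aestronglyMeasurable_fcoef_mul {μ : Measure ℝ} [SFinite μ] {W : ℝ → Torus L → ℂ}
    (hW : AEStronglyMeasurable (Function.uncurry W) (μ.prod (haar L)))
    (hWc : ∀ᵐ t ∂μ, Continuous (W t)) {v : ℝ → L2 L}
    (hv : ∀ k, AEStronglyMeasurable (fun t => coeff L (v t) k) μ) (n : Fin 2 → ℤ) :
    AEStronglyMeasurable (fun t => fcoef L (fun x => W t x * v t x) n) μ := by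
  refine aestronglyMeasurable_of_tendsto_ae (u := (atTop : Filter (Finset (Fin 2 → ℤ))))
    (f := fun s t => ∑ k ∈ s,
      (∫ x, conj (character L n x) * W t x * character L k x ∂(haar L)) * coeff L (v t) k)
    (fun s => ?_) ?_
  · refine Finset.aestronglyMeasurable_fun_sum s fun k _ => AEStronglyMeasurable.mul ?_ (hv k)
    have h1 : AEStronglyMeasurable (fun p : ℝ × Torus L => conj (character L n p.2))
        (μ.prod (haar L)) := Continuous.aestronglyMeasurable (by fun_prop)
    have h2 : AEStronglyMeasurable (fun p : ℝ × Torus L => character L k p.2)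
        (μ.prod (haar L)) := Continuous.aestronglyMeasurable (by fun_prop)
    exact ((h1.mul hW).mul h2).integral_prod_right'
  · filter_upwards [hWc] with t ht
    exact hasSum_fcoef_mul ht (v t) n

theorem fcoef_sum {ι : Type*} (s : Finset ι) {F : ι → Torus L → ℂ}
    (hF : ∀ j ∈ s, MemLp (F j) 2 (haar L)) (n : Fin 2 → ℤ) :
    fcoef L (fun x => ∑ j ∈ s, F j x) n = ∑ j ∈ s, fcoef L (F j) n := by
  simp only [fcoef, Finset.mul_sum]
  exact integral_finsetSum _ fun j hj => integrable_conj_character_mul (hF j hj) n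

theorem continuous_coeff_conjIf_schr (g : L2 L) (τ : Bool) (k : Fin 2 → ℤ) :
    Continuous fun t => fcoef L (fun x => conjIf τ ((schr L t g : Torus L → ℂ) x)) k := by
  cases τ
  · have h : ∀ t, fcoef L (fun x => conjIf false ((schr L t g : Torus L → ℂ) x)) k =
        phase L t k * coeff L g k := fun t => coeff_schr L t g k
    simp only [h]
    exact (continuous_phase L k).mul continuous_const
  · have h : ∀ t, fcoef L (fun x => conjIf true ((schr L t g : Torus L → ℂ) x)) k =
        conj (phase L t (-k) * coeff L g (-k)) := fun t => by
      rw [← coeff_schr L t g (-k)]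
      exact fcoef_conj _ k
    simp only [h]
    exact Complex.continuous_conj.comp ((continuous_phase L (-k)).mul continuous_const)

theorem aestronglyMeasurable_fcoef_potentialMul {W : Bool → ℝ → Torus L → ℂ}
    (hW : ∀ τ, AEStronglyMeasurable (Function.uncurry (W τ))
      ((volume.restrict (Ioo (-1 : ℝ) 1)).prod (haar L)))
    (hWc : ∀ τ, ∀ t ∈ Ioo (-1 : ℝ) 1, Continuous (W τ t)) (g : L2 L) (n : Fin 2 → ℤ) :
    AEStronglyMeasurable (fun t => fcoef L (potentialMul W g t) n)
      (volume.restrict (Ioo (-1) 1)) := by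
  let v : Bool → ℝ → L2 L := fun τ t =>
    (memLp_conjIf (Lp.memLp (schr L t g)) τ).toLp (fun x => conjIf τ ((schr L t g : Torus L → ℂ) x))
  have hv : ∀ τ k, AEStronglyMeasurable (fun t => coeff L (v τ t) k)
      (volume.restrict (Ioo (-1) 1)) := fun τ k => by
    simp only [v, coeff_toLp]
    exact (continuous_coeff_conjIf_schr g τ k).aestronglyMeasurable
  have hae : ∀ τ, ∀ᵐ t ∂(volume.restrict (Ioo (-1 : ℝ) 1)), Continuous (W τ t) := fun τ => by
    filter_upwards [ae_restrict_mem measurableSet_Ioo] with t ht using hWc τ t ht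
  refine (Finset.aestronglyMeasurable_fun_sum Finset.univ fun τ _ =>
    aestronglyMeasurable_fcoef_mul (hW τ) (hae τ) (hv τ) n).congr ?_
  filter_upwards [ae_restrict_mem measurableSet_Ioo] with t ht
  have h : fcoef L (potentialMul W g t) n =
      ∑ τ, fcoef L (fun x => W τ t x * conjIf τ ((schr L t g : Torus L → ℂ) x)) n :=
    fcoef_sum _ (fun τ _ => memLp_continuous_mul (hWc τ t ht) (memLp_conjIf (Lp.memLp _) τ)) n
  rw [h]
  refine Finset.sum_congr rfl fun τ _ => fcoef_congr_ae ?_ n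
  filter_upwards [MemLp.coeFn_toLp (memLp_conjIf (Lp.memLp (schr L t g)) τ)] with x hx
  simp only [v]
  rw [hx]

end Measurability

/-! ### Assembling the estimate of the N norm -/

section Main

variable {L : Fin 2 → ℝ} [∀ i, Fact (0 < L i)]

/-- The `N` norm of the product of concentrated multipliers with a high frequency free solution. -/
theorem nNorm_potentialMul_le {A N B : ℝ} (hA : 0 ≤ A) (hN : 2 ≤ N) (hB : 2 ≤ B)
    {W : Bool → ℝ → Torus L → ℂ} (hW : IsConcentrated A N W)
    (hWm : ∀ τ, AEStronglyMeasurable (Function.uncurry (W τ))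
      ((volume.restrict (Ioo (-1 : ℝ) 1)).prod (haar L)))
    {g : L2 L} (hg : ∀ n, coeff L g n ≠ 0 → B * N ≤ ‖freq L n‖)
    (hgE : ∑' n, japanese L n * ‖coeff L g n‖ₑ ^ 2 ≠ ∞) :
    nNorm L (-1) 1 (potentialMul W g) ≤
      (ENNReal.ofReal (32 * ((640 + 324 * smoothingConst L) * (A ^ 2 * (B⁻¹ + N⁻¹)))) *
        ∑' n, japanese L n * ‖coeff L g n‖ₑ ^ 2) ^ (1 / 2 : ℝ) := by
  have hN0 : 0 < N := by linarith
  have hB0 : 0 < B := by linarith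
  set a := (N ^ 2)⁻¹ with ha
  have ha0 : 0 < a := by positivity
  have ha1 : a < 1 := inv_lt_one_of_one_lt₀ (by nlinarith)
  set H : ℝ → L2 L := fun t => toL2 L (potentialMul W g t) with hH
  have hmem : ∀ t ∈ Ioo (-1 : ℝ) 1, MemLp (potentialMul W g t) 2 (haar L) := fun t ht =>
    memLp_potentialMul (fun τ => hW.cont τ t ht) g
  have hcoef : ∀ t ∈ Ioo (-1 : ℝ) 1, ∀ n, coeff L (H t) n = fcoef L (potentialMul W g t) n :=
    fun t ht n => coeff_toL2 (hmem t ht) n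
  have hfm := aestronglyMeasurable_fcoef_potentialMul hWm hW.cont g
  have hHm : AEStronglyMeasurable H (volume.restrict (Ioo (-1 : ℝ) 1)) := by
    refine aestronglyMeasurable_of_coeff L fun n => (hfm n).congr ?_
    filter_upwards [ae_restrict_mem measurableSet_Ioo] with t ht using (hcoef t ht n).symm
  have hHb : ∀ t ∈ Ioo (-1 : ℝ) 1, ‖H t‖ ≤ 2 * (A * N ^ 2) * ‖g‖ := by
    intro t ht
    rw [← norm_schr L t g, hH]
    simp only [toL2_eq (hmem t ht)]
    refine Lp.norm_le_mul_norm_of_ae_le_mul ?_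
    filter_upwards [(hmem t ht).coeFn_toLp] with x hx
    rw [hx, mul_assoc]
    refine (norm_sum_le _ _).trans (sum_bool_le fun τ => ?_)
    rw [norm_mul, norm_conjIf]
    exact mul_le_mul_of_nonneg_right (hW.bound τ t ht x) (norm_nonneg _)
  have hHint : IntegrableOn H (Ioo (-1) 1) := by
    refine Integrable.of_bound hHm (2 * (A * N ^ 2) * ‖g‖) ?_
    filter_upwards [ae_restrict_mem measurableSet_Ioo] with t ht using hHb t ht
  have hHint2 : IntegrableOn (fun t => ‖H t‖ ^ 2) (Ioo (-1) 1) := by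
    refine Integrable.of_bound (hHm.norm.pow 2) ((2 * (A * N ^ 2) * ‖g‖) ^ 2) ?_
    filter_upwards [ae_restrict_mem measurableSet_Ioo] with t ht
    rw [Real.norm_of_nonneg (by positivity)]
    exact pow_le_pow_left₀ (norm_nonneg _) (hHb t ht) 2
  -- Nothing is known about the multipliers for |t| ≥ 1; the Duhamel integral at times in (-1, 1)
  -- does not see the truncation.
  set H' : ℝ → L2 L := (Ioo (-1 : ℝ) 1).indicator H with hH'
  have hsupp : ∀ t, a < |t| → H' t = 0 := by
    intro t hta
    by_cases ht : t ∈ Ioo (-1 : ℝ) 1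
    · rw [hH', indicator_of_mem ht]
      refine ext_coeff L fun n => ?_
      rw [hcoef t ht, coeff_zero]
      have h0 : potentialMul W g t = fun _ => 0 := funext fun x =>
        potentialMul_eq_zero hW ht (fun h => by
          have := abs_le.2 h
          linarith) x
      rw [h0]; simp [fcoef]
    · rw [hH', indicator_of_notMem ht]
  have hH'2 : Integrable fun s => ‖H' s‖ ^ 2 := by
    have : (fun s => ‖H' s‖ ^ 2) = (Ioo (-1 : ℝ) 1).indicator fun t => ‖H t‖ ^ 2 := by
      ext s
      by_cases hs : s ∈ Ioo (-1 : ℝ) 1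
      · rw [hH', indicator_of_mem hs, indicator_of_mem hs]
      · rw [hH', indicator_of_notMem hs, indicator_of_notMem hs]; simp
    rw [this]
    exact hHint2.integrable_indicator measurableSet_Ioo
  have hlin : ∀ n, ∫⁻ s, ‖coeff L (H' s) n‖ₑ ^ 2 =
      ∫⁻ t in Ioo (-1 : ℝ) 1, ‖fcoef L (potentialMul W g t) n‖ₑ ^ 2 := by
    intro n
    rw [← lintegral_indicator measurableSet_Ioo]
    congr 1; ext s
    by_cases hs : s ∈ Ioo (-1 : ℝ) 1
    · rw [hH', indicator_of_mem hs, indicator_of_mem hs, hcoef s hs]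
    · rw [hH', indicator_of_notMem hs, indicator_of_notMem hs, coeff_zero]; simp
  have hmain := sum_japanese_mul_lintegral_le hA (by linarith : (1 : ℝ) ≤ N) hB hW hg
    fun n => (hfm n).aemeasurable
  simp only [← hlin] at hmain
  have hx := xNorm_duhamel_le L ha0 ha1 (hHint.integrable_indicator measurableSet_Ioo) hH'2 hsupp
    (E := _) hmain (ENNReal.mul_ne_top ENNReal.ofReal_ne_top hgE) (u := duhamel L (-1) H)
    (fun t ht => by
      refine intervalIntegral.integral_congr_ae (ae_of_all _ fun s hs => ?_)
      rw [uIoc_of_le ht.1.le] at hs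
      have hs' : s ∈ Ioo (-1 : ℝ) 1 := ⟨hs.1, hs.2.trans_lt ht.2⟩
      rw [indicator_of_mem hs'])
  rw [nNorm, if_pos ⟨by
    filter_upwards [ae_restrict_mem measurableSet_Ioo] with t ht using hmem t ht, hHint⟩]
  refine hx.trans_eq ?_
  rw [ofReal_mul_mul (by positivity)]
  congr 3
  rw [ha]; field_simp

theorem IsCutoff.exists_bound {η : EuclideanSpace ℝ (Fin 2) → ℝ} (hη : IsCutoff η) :
    ∃ K : ℝ, 0 ≤ K ∧ ∀ x, ‖((1 - η x : ℝ) : ℂ)‖ ≤ K := by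
  have hc : HasCompactSupport η :=
    (isCompact_closedBall (0 : EuclideanSpace ℝ (Fin 2)) 2).of_isClosed_subset
      (isClosed_tsupport η) hη.support
  obtain ⟨K, hK⟩ := hc.exists_bound_of_continuous hη.smooth.continuous
  refine ⟨1 + K, by linarith [(norm_nonneg _).trans (hK 0)], fun x => ?_⟩
  rw [Complex.norm_real]
  refine (norm_sub_le _ _).trans ?_
  rw [norm_one]
  linarith [hK x]

theorem coeff_highFreq {η : EuclideanSpace ℝ (Fin 2) → ℝ} (hη : IsCutoff η) (M : ℝ) (f : L2 L)
    (n : Fin 2 → ℤ) :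
    coeff L (highFreq L η M f) n = ((1 - η (M⁻¹ • freq L n) : ℝ) : ℂ) * coeff L f n := by
  obtain ⟨K, -, hK⟩ := hη.exists_bound
  exact coeff_multiplier L (fun n => hK _) f n

theorem le_norm_freq_of_coeff_highFreq_ne_zero {η : EuclideanSpace ℝ (Fin 2) → ℝ}
    (hη : IsCutoff η) {M : ℝ} (hM : 0 < M) {f : L2 L} {n : Fin 2 → ℤ}
    (h : coeff L (highFreq L η M f) n ≠ 0) : M ≤ ‖freq L n‖ := by
  by_contra hlt
  apply h
  rw [coeff_highFreq hη, hη.eq_one]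
  · simp
  · rw [norm_smul, norm_inv, Real.norm_of_nonneg hM.le, inv_mul_le_iff₀ hM]
    linarith

theorem hNorm_half_eq (f : L2 L) :
    hNorm L (1 / 2) f = (∑' n, japanese L n * ‖coeff L f n‖ₑ ^ 2) ^ (1 / 2 : ℝ) := rfl

/-- The estimate produces the exponent 1/2, which is weakened here to 1/200. -/
theorem sqrt_inv_add_inv_le {B N : ℝ} (hB : 1 ≤ B) (hN : 1 ≤ N) :
    √(B⁻¹ + N⁻¹) ≤ B ^ (-(1 / 200) : ℝ) + N ^ (-(1 / 200) : ℝ) := by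
  have h : ∀ {x : ℝ}, 1 ≤ x → √(x⁻¹) ≤ x ^ (-(1 / 200) : ℝ) := fun {x} hx => by
    have hx0 : 0 < x := by linarith
    rw [Real.sqrt_eq_rpow, ← Real.rpow_neg_one, ← Real.rpow_mul hx0.le]
    exact Real.rpow_le_rpow_of_exponent_le hx (by norm_num)
  have hB0 : 0 < B := by linarith
  have hN0 : 0 < N := by linarith
  refine le_trans ?_ (add_le_add (h hB) (h hN))
  rw [Real.sqrt_le_left (by positivity)]
  have h1 := Real.sq_sqrt (inv_pos.2 hB0).le
  have h2 := Real.sq_sqrt (inv_pos.2 hN0).le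
  nlinarith [mul_nonneg (Real.sqrt_nonneg B⁻¹) (Real.sqrt_nonneg N⁻¹)]

end Main

end TorusNLS

theorem lemmaA1 (L : Fin 2 → ℝ) [∀ i, Fact (0 < L i)]
    (η : EuclideanSpace ℝ (Fin 2) → ℝ) (hη : TorusNLS.IsCutoff η)
    (κ : (Fin 4 → Bool) → Bool → ℂ) :
    ∃ C : ℝ, 0 < C ∧
      ∀ B N : ℕ, 2 ≤ B → (∃ k : ℕ, B = 2 ^ k) → 2 ≤ N → (∃ k : ℕ, N = 2 ^ k) →
      ∀ ω : ℝ → TorusNLS.Torus L → ℂ,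
        AEStronglyMeasurable (Function.uncurry ω)
          ((volume.restrict (Ioo (-1 : ℝ) 1)).prod (TorusNLS.haar L)) →
        (∀ t ∈ Ioo (-1 : ℝ) 1, Differentiable ℝ (TorusNLS.lift (ω t))) →
        (∀ t ∈ Ioo (-1 : ℝ) 1, ∀ x : EuclideanSpace ℝ (Fin 2),
          ‖TorusNLS.lift (ω t) x‖ ≤ (N : ℝ) ^ (1 / 2 : ℝ) *
            {p : ℝ × TorusNLS.Torus L |
              |p.1| ≤ (N : ℝ) ^ (-2 : ℝ) ∧ TorusNLS.torusAbs p.2 ≤ (N : ℝ) ^ (-1 : ℝ)}.indicator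
              (fun _ => (1 : ℝ)) (t, fun i => (x i : AddCircle (L i))) ∧
          TorusNLS.gradAbs (ω t) x ≤ (N : ℝ) ^ (1 + 1 / 2 : ℝ) *
            {p : ℝ × TorusNLS.Torus L |
              |p.1| ≤ (N : ℝ) ^ (-2 : ℝ) ∧ TorusNLS.torusAbs p.2 ≤ (N : ℝ) ^ (-1 : ℝ)}.indicator
              (fun _ => (1 : ℝ)) (t, fun i => (x i : AddCircle (L i)))) →
      ∀ f : TorusNLS.L2 L, TorusNLS.hNorm L (1 / 2) f < ∞ →
        TorusNLS.nNorm L (-1) 1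
            (fun t x => TorusNLS.quintic κ (ω t x)
              ((TorusNLS.schr L t (TorusNLS.highFreq L η ((B : ℝ) * N) f) :
                TorusNLS.Torus L → ℂ) x)) ≤
          ENNReal.ofReal (C * ((B : ℝ) ^ (-(1 / 200) : ℝ) + (N : ℝ) ^ (-(1 / 200) : ℝ))) *
            TorusNLS.hNorm L (1 / 2) f := by
  obtain ⟨K, hK0, hK⟩ := hη.exists_bound
  have hS0 := TorusNLS.smoothingConst_nonneg (L := L)
  have hκ := TorusNLS.coefSum_nonneg κ
  set D : ℝ := 32 * (640 + 324 * TorusNLS.smoothingConst L) * (4 * TorusNLS.coefSum κ) ^ 2 * K ^ 2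
    with hD
  have hD0 : 0 ≤ D := by positivity
  -- The summand 1 only ensures a positive constant, as D = 0 when all coefficients κ vanish.
  refine ⟨√D + 1, by positivity, ?_⟩
  intro B N hB _ hN _ ω hωm hωd hω f hf
  have hBr : (2 : ℝ) ≤ B := by exact_mod_cast hB
  have hNr : (2 : ℝ) ≤ N := by exact_mod_cast hN
  have hN0 : (0 : ℝ) < N := by linarith
  have hB0 : (0 : ℝ) < B := by linarith
  have e2 : (N : ℝ) ^ (-2 : ℝ) = ((N : ℝ) ^ 2)⁻¹ := by
    rw [Real.rpow_neg hN0.le]; norm_cast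
  have e1 : (N : ℝ) ^ (-1 : ℝ) = (N : ℝ)⁻¹ := Real.rpow_neg_one _
  have hind : ∀ p : ℝ × TorusNLS.Torus L, {p : ℝ × TorusNLS.Torus L |
      |p.1| ≤ (N : ℝ) ^ (-2 : ℝ) ∧ TorusNLS.torusAbs p.2 ≤ (N : ℝ) ^ (-1 : ℝ)}.indicator
      (fun _ => (1 : ℝ)) p ≤ 1 := fun p => indicator_le_self' (fun _ _ => zero_le_one) p
  have hconc := TorusNLS.isConcentrated_quarticFactor κ (by linarith : (1 : ℝ) ≤ N) hωd
    (fun t ht x => by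
      obtain ⟨z, rfl⟩ := TorusNLS.isOpenQuotientMap_proj.surjective x
      exact ((hω t ht z).1).trans (mul_le_of_le_one_right (by positivity) (hind _)))
    (fun t ht x hx => by
      obtain ⟨z, rfl⟩ := TorusNLS.isOpenQuotientMap_proj.surjective x
      by_contra hcon
      apply hx
      have h := (hω t ht z).1
      rw [indicator_of_notMem, mul_zero] at h
      · exact norm_le_zero_iff.1 h
      · rw [← e2, ← e1] at hcon
        exact hcon)
    (fun t ht x => ((hω t ht x).2).trans (mul_le_of_le_one_right (by positivity) (hind _)))
  set g := TorusNLS.highFreq L η ((B : ℝ) * N) f with hg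
  set E := ∑' n, TorusNLS.japanese L n * ‖TorusNLS.coeff L f n‖ₑ ^ 2 with hE
  have hEtop : E ≠ ∞ := by
    intro h
    rw [TorusNLS.hNorm_half_eq, ← hE, h, ENNReal.top_rpow_of_pos (by norm_num)] at hf
    exact lt_irrefl _ hf
  have hgE : ∑' n, TorusNLS.japanese L n * ‖TorusNLS.coeff L g n‖ₑ ^ 2 ≤
      ENNReal.ofReal (K ^ 2) * E := by
    rw [hE, ← ENNReal.tsum_mul_left]
    refine ENNReal.tsum_le_tsum fun n => ?_
    rw [TorusNLS.coeff_highFreq hη, enorm_mul, mul_pow, mul_left_comm]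
    gcongr
    exact TorusNLS.enorm_sq_le_ofReal (hK _)
  have hfun : (fun t x => TorusNLS.quintic κ (ω t x)
      ((TorusNLS.schr L t g : TorusNLS.Torus L → ℂ) x)) =
      TorusNLS.potentialMul (fun τ t x => TorusNLS.quarticFactor κ τ (ω t x)) g := by
    funext t x
    exact TorusNLS.quintic_eq κ _ _
  rw [hfun]
  refine (TorusNLS.nNorm_potentialMul_le (by positivity) hNr hBr hconc (fun τ => ?_)
    (fun n hn => TorusNLS.le_norm_freq_of_coeff_highFreq_ne_zero hη (by positivity) hn)
    (ne_top_of_le_ne_top (ENNReal.mul_ne_top ENNReal.ofReal_ne_top hEtop) hgE)).trans ?_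
  · exact (TorusNLS.continuous_quarticFactor κ τ).comp_aestronglyMeasurable hωm
  rw [TorusNLS.hNorm_half_eq, ← hE]
  calc _ ≤ (ENNReal.ofReal (D * ((B : ℝ)⁻¹ + (N : ℝ)⁻¹)) * E) ^ (1 / 2 : ℝ) := by
        refine ENNReal.rpow_le_rpow ?_ (by norm_num)
        refine (mul_le_mul_right hgE _).trans_eq ?_
        rw [TorusNLS.ofReal_mul_mul (by positivity)]
        congr 2
        rw [hD]; ring
    _ = ENNReal.ofReal (√D * √((B : ℝ)⁻¹ + (N : ℝ)⁻¹)) * E ^ (1 / 2 : ℝ) := by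
        rw [ENNReal.mul_rpow_of_nonneg _ _ (by norm_num),
          ENNReal.ofReal_rpow_of_nonneg (by positivity) (by norm_num), ← Real.sqrt_eq_rpow,
          Real.sqrt_mul hD0]
    _ ≤ _ := by
        refine mul_le_mul_left (ENNReal.ofReal_le_ofReal ?_) _
        exact mul_le_mul (by linarith) (TorusNLS.sqrt_inv_add_inv_le (by linarith) (by linarith))
          (Real.sqrt_nonneg _) (by positivity)
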